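/- Let $\mathbb{T}\subseteq\mathbb{R}$ be a time scale (a nonempty closed set), let $a<b$ be points of $\mathbb{T}$, and regard $[a,b]=\{t\in\mathbb{T}: a\le t\le b\}$ as a time scale with forward and backward jump operators $\sigma(t)=\inf\{s\in[a,b]:s>t\}$ and $\rho(t)=\sup\{s\in[a,b]:s<t\}$ (with $\sigma(b)=b$, $\rho(a)=a$). For a time scale $S$ with maximum $m$ put $S^\kappa=S\setminus(\rho_S(m),m]$, where $\rho_S$ is the backward jump operator of $S$, and $S^{\kappa^2}=(S^\kappa)^\kappa$. For $y:[a,b]\to\mathbb{R}$ let $y^\Delta$ (on $[a,b]^\kappa$) be its delta derivative, $y^{\Delta\Delta}=(y^\Delta)^\Delta$ (on $[a,b]^{\kappa^2}$, the outer derivative being taken on the time scale $[a,b]^\kappa$), and $y^\sigma=y\circ\sigma$. A function is rd-continuous if it is continuous at the right-dense points ($\sigma(t)=t$) and has finite left-sided limits at the left-dense points ($\rho(t)=t$) of its domain; $C^2_{\mathrm{rd}}$ is the set of twice delta differentiable $y:[a,b]\to\mathbb{R}$ with $y^{\Delta\Delta}$ rd-continuous. The delta integral is $\int_a^b f(t)\,\Delta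 t=F(b)-F(a)$, where $F^\Delta=f$ on $[a,b]^\kappa$. Let $q:[a,b]\to\mathbb{R}$ be continuous. A real number $\lambda$ is an eigenvalue, with eigenfunction $y$, if $y\in C^2_{\mathrm{rd}}$ is not identically $0$ on $[a,b]$, $y(a)=y(b)=0$, and $$y^{\Delta\Delta}(t)+q(t)y^\sigma(t)+\lambda y^\sigma(t)=0\quad\text{for all } t\in[a,b]^{\kappa^2}\text{ with }\sigma(t)\in[a,b]^\kappa .$$ (The condition $\sigma(t)\in[a,b]^\kappa$ holds for all $t\in[a,b]^{\kappa^2}$, unless $[a,b]=\{a,b\}$ or $\rho(b)<b$ is left-dense, in which case it omits only $t=\rho(b)$.) The first eigenvalue $\lambda_1$ is the least eigenvalue. Put $$J(y)=\int_a^b\big((y^\Delta)^2(t)-q(t)(y^\sigma)^2(t)\big)\Delta t,\qquad I(y)=\int_a^b (y^\sigma)^2(t)\,\Delta t .$$ If $[a,b]$ has at least three points, then the first eigenvalue $\lambda_1$ exists and has an eigenfunction $y_1$ with $I(y_1)=1$. Moreover, whenever $\lambda_1$ is the first eigenvalue and $y_1$ is an eigenfunction for $\lambda_1$ with $I(y_1)=1$,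 the functional $J$ restricted to the set of all $y\in C^2_{\mathrm{rd}}$ with $y(a)=y(b)=0$ and $I(y)=1$ attains its minimum at $y_1$, and $J(y_1)=\lambda_1$. -/

import Mathlib

namespace TimeScale

noncomputable section

open Set Filter Topology

/-- The forward jump operator of the time scale `T`, with the convention `inf ∅ = sup T`. -/
def sigma (T : Set ℝ) (t : ℝ) : ℝ :=
  open Classical in
  if {s | s ∈ T ∧ t < s}.Nonempty then sInf {s | s ∈ T ∧ t < s} else sSup T

/-- The backward jump operator of the time scale `T`, with the convention `sup ∅ = inf T`. -/
def rho (T : Set ℝ) (t : ℝ) : ℝ :=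
  open Classical in
  if {s | s ∈ T ∧ s < t}.Nonempty then sSup {s | s ∈ T ∧ s < t} else sInf T

/-- The set `T^κ = T \ (ρ(sup T), sup T]` (and `T^κ = T` if `T` is unbounded above). -/
def kappa (T : Set ℝ) : Set ℝ :=
  open Classical in
  if BddAbove T then T \ Ioc (rho T (sSup T)) (sSup T) else T

/-- The time scale interval `[a, b] = {t ∈ 𝕋 : a ≤ t ≤ b}`, itself a time scale. -/
def interval (𝕋 : Set ℝ) (a b : ℝ) : Set ℝ := {t | t ∈ 𝕋 ∧ a ≤ t ∧ t ≤ b}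

/-- `d` is a delta derivative of `f` at `t`, for the time scale `T`.
Only the values of `f` on `T` matter. -/
def HasDeltaDerivAt (T : Set ℝ) (f : ℝ → ℝ) (d t : ℝ) : Prop :=
  ∀ ε > 0, ∃ δ > 0, ∀ s ∈ T, |s - t| < δ →
    |f (sigma T t) - f s - d * (sigma T t - s)| ≤ ε * |sigma T t - s|

/-- `f` is delta differentiable at `t`, for the time scale `T`. -/
def DeltaDifferentiableAt (T : Set ℝ) (f : ℝ → ℝ) (t : ℝ) : Prop :=
  ∃ d, HasDeltaDerivAt T f d t

/-- The delta derivative `f^Δ(t)` (and `0` where `f` is not delta differentiable). -/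
def deltaDeriv (T : Set ℝ) (f : ℝ → ℝ) (t : ℝ) : ℝ :=
  open Classical in
  if h : DeltaDifferentiableAt T f t then h.choose else 0

/-- The second delta derivative `f^{ΔΔ} = (f^Δ)^Δ`; since `f^Δ` is a function on `T^κ`, the outer
delta derivative is taken for the time scale `T^κ`. -/
def deltaDeriv2 (T : Set ℝ) (f : ℝ → ℝ) : ℝ → ℝ := deltaDeriv (kappa T) (deltaDeriv T f)

/-- Rd-continuity of a function `f` with domain `D ⊆ T`: it is continuous at the right-dense
points and has a finite left-sided limit at the left-dense points, where right-dense and left-dense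
refer to the time scale `T`. -/
def RdContinuousOn (T D : Set ℝ) (f : ℝ → ℝ) : Prop :=
  ∀ t ∈ D, (sigma T t = t → ContinuousWithinAt f D t) ∧
    (rho T t = t → ∃ l, Tendsto f (𝓝[D ∩ Iio t] t) (𝓝 l))

/-- The class `C²_rd`: twice delta differentiable functions (on `T^κ` and `T^{κ²}` respectively)
with rd-continuous second delta derivative. -/
structure IsC2rd (T : Set ℝ) (y : ℝ → ℝ) : Prop where
  diff : ∀ t ∈ kappa T, DeltaDifferentiableAt T y t
  diff2 : ∀ t ∈ kappa (kappa T), DeltaDifferentiableAt (kappa T) (deltaDeriv T y) t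
  rd : RdContinuousOn T (kappa (kappa T)) (deltaDeriv2 T y)

/-- `F` is an antiderivative of `f` on the time scale `T`. -/
def IsAntiderivative (T : Set ℝ) (f F : ℝ → ℝ) : Prop :=
  ∀ t ∈ kappa T, HasDeltaDerivAt T F (f t) t

/-- The delta integral `∫_a^b f(t) Δt = F(b) - F(a)`, where `F` is an antiderivative of `f` (every
rd-continuous function has one; the value is `0` by convention if there is none). -/
def deltaIntegral (T : Set ℝ) (a b : ℝ) (f : ℝ → ℝ) : ℝ :=
  open Classical in
  if h : ∃ F, IsAntiderivative T f F then h.choose b - h.choose a else 0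

/-- `y` solves `y^{ΔΔ} + q y^σ + lam y^σ = 0` on the time scale `T` (here a time scale interval).
The equation is imposed at the points `t` of `T^{κ²}` for which `y^Δ(σ(t))` is defined, i.e.
`σ(t) ∈ T^κ`. This is all of `T^{κ²}`, except that `t = ρ(max T)` is left out if it is smaller than
`max T` and left-dense; at that point `C²_rd` still forces `y^Δ` to be continuous. (It also leaves
out the only point of `T^{κ²}` if `T` has just two points.) -/
def IsSolution (T : Set ℝ) (q : ℝ → ℝ) (lam : ℝ) (y : ℝ → ℝ) : Prop :=
  IsC2rd T y ∧ ∀ t ∈ kappa (kappa T), sigma T t ∈ kappa T →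
    deltaDeriv2 T y t + q t * y (sigma T t) + lam * y (sigma T t) = 0

/-- `y` is an eigenfunction for `lam`: a nontrivial solution on `[a, b]` with `y(a) = y(b) = 0`. -/
def IsEigenfunction (𝕋 : Set ℝ) (a b : ℝ) (q : ℝ → ℝ) (lam : ℝ) (y : ℝ → ℝ) : Prop :=
  IsSolution (interval 𝕋 a b) q lam y ∧ y a = 0 ∧ y b = 0 ∧ ∃ t ∈ interval 𝕋 a b, y t ≠ 0

/-- The set of eigenvalues of the Sturm–Liouville problem. -/
def eigenvalues (𝕋 : Set ℝ) (a b : ℝ) (q : ℝ → ℝ) : Set ℝ :=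
  {lam | ∃ y, IsEigenfunction 𝕋 a b q lam y}

/-- `J(y) = ∫_a^b ((y^Δ)² - q (y^σ)²) Δt`. -/
def J (𝕋 : Set ℝ) (a b : ℝ) (q y : ℝ → ℝ) : ℝ :=
  deltaIntegral (interval 𝕋 a b) a b fun t =>
    deltaDeriv (interval 𝕋 a b) y t ^ 2 - q t * y (sigma (interval 𝕋 a b) t) ^ 2

/-- `I(y) = ∫_a^b (y^σ)² Δt`. -/
def I (𝕋 : Set ℝ) (a b : ℝ) (y : ℝ → ℝ) : ℝ :=
  deltaIntegral (interval 𝕋 a b) a b fun t => y (sigma (interval 𝕋 a b) t) ^ 2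

/-- The `C²_rd` functions on `[a, b]` with `y(a) = y(b) = 0` and `I(y) = 1`. -/
def admissible (𝕋 : Set ℝ) (a b : ℝ) : Set (ℝ → ℝ) :=
  {y | IsC2rd (interval 𝕋 a b) y ∧ y a = 0 ∧ y b = 0 ∧ I 𝕋 a b y = 1}

end

end TimeScale

/-! The proof combines shooting with Picone's identity. For every real `lam` let `y` be the solution
of the equation with `y(a) = 0`, `y^Δ(a) = 1`. If `y > 0` on `(a, b]`, then for every `η` vanishing
at both ends the function `∫_a^t ((η^Δ)² - (q + lam)(η^σ)²) - η² y^Δ / y` is nondecreasing, which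
gives `lam * I η ≤ J η` (`IsShot.picone`).

Let `S` be the set of such `lam`. It contains every `lam` with `q + lam ≤ 0` (`pos_of_nonpos`), it
is bounded above by the Rayleigh quotient of one test function, and it is open (`eventually_pos`).
At `lam = sup S` the Rayleigh inequality survives by closedness, and the solution is nonnegative by
continuous dependence, hence positive inside (`pos_of_nonneg`). If it were also positive at `b`,
openness would put larger parameters in `S`; so it vanishes at `b` and `lam` is an eigenvalue
(`exists_first_eigenvalue`). Conversely `J y = μ * I y` for an eigenfunction of `μ` (`J_eq_mul`),
because `y y^Δ` is an antiderivative of the combined integrand. So `lam` is the least eigenvalue and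
the minimum of `J` on `I = 1`.

Delta integrals are realised as Lebesgue integrals of step extensions (`primitive`). The initial
value problem becomes a Volterra equation on `C([a, b])`, solved by inverting an operator that
depends continuously on `lam`. -/

namespace TimeScale

open Set Filter Topology MeasureTheory

variable {T : Set ℝ} {a b t s : ℝ}

/-! ### Jump operators and `T^κ` on a compact time scale. -/

/-- `T` is a compact time scale with least element `a` and greatest element `b`. -/
structure IsCompactScale (T : Set ℝ) (a b : ℝ) : Prop where
  isCompact : IsCompact T
  isLeast : IsLeast T a
  isGreatest : IsGreatest T b

namespace IsCompactScale

theorem left_mem (hT : IsCompactScale T a b) : a ∈ T := hT.isLeast.1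

theorem right_mem (hT : IsCompactScale T a b) : b ∈ T := hT.isGreatest.1

theorem left_le (hT : IsCompactScale T a b) (ht : t ∈ T) : a ≤ t := hT.isLeast.2 ht

theorem le_right (hT : IsCompactScale T a b) (ht : t ∈ T) : t ≤ b := hT.isGreatest.2 ht

theorem left_le_right (hT : IsCompactScale T a b) : a ≤ b := hT.left_le hT.right_mem

theorem isClosed (hT : IsCompactScale T a b) : IsClosed T := hT.isCompact.isClosed

theorem sSup_eq (hT : IsCompactScale T a b) : sSup T = b := hT.isGreatest.csSup_eq

theorem sInf_eq (hT : IsCompactScale T a b) : sInf T = a := hT.isLeast.csInf_eq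

theorem bddAbove (hT : IsCompactScale T a b) : BddAbove T := hT.isCompact.bddAbove

theorem bddBelow (hT : IsCompactScale T a b) : BddBelow T := hT.isCompact.bddBelow

theorem sigma_of_lt (hT : IsCompactScale T a b) (ht : t < b) :
    sigma T t = sInf {s | s ∈ T ∧ t < s} :=
  if_pos ⟨b, hT.right_mem, ht⟩

theorem sigma_of_le (hT : IsCompactScale T a b) (ht : b ≤ t) : sigma T t = b := by
  rw [sigma, if_neg, hT.sSup_eq]
  rintro ⟨s, hs, hts⟩
  exact absurd (hT.le_right hs) (by linarith)

theorem sigma_right (hT : IsCompactScale T a b) : sigma T b = b := hT.sigma_of_le le_rfl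

theorem sigma_mem (hT : IsCompactScale T a b) (t : ℝ) : sigma T t ∈ T := by
  rcases lt_or_ge t b with h | h
  · rw [hT.sigma_of_lt h]
    have hne : {s | s ∈ T ∧ t < s}.Nonempty := ⟨b, hT.right_mem, h⟩
    have hbd : BddBelow {s | s ∈ T ∧ t < s} := hT.bddBelow.mono fun s hs => hs.1
    exact closure_minimal (fun s hs => hs.1) hT.isClosed (csInf_mem_closure hne hbd)
  · rw [hT.sigma_of_le h]; exact hT.right_mem

theorem sigma_le (hT : IsCompactScale T a b) (hs : s ∈ T) (h : t < s) : sigma T t ≤ s := by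
  rw [hT.sigma_of_lt (h.trans_le (hT.le_right hs))]
  exact csInf_le (hT.bddBelow.mono fun s hs => hs.1) ⟨hs, h⟩

theorem le_sigma_of_le (hT : IsCompactScale T a b) (h : t ≤ b) : t ≤ sigma T t := by
  rcases h.lt_or_eq with h | rfl
  · rw [hT.sigma_of_lt h]
    exact le_csInf ⟨b, hT.right_mem, h⟩ fun s hs => hs.2.le
  · exact hT.sigma_right.ge

theorem le_sigma (hT : IsCompactScale T a b) (ht : t ∈ T) : t ≤ sigma T t :=
  hT.le_sigma_of_le (hT.le_right ht)

theorem sigma_mono (hT : IsCompactScale T a b) : Monotone (sigma T) := by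
  intro s t hst
  rcases lt_or_ge t b with h | h
  · rw [hT.sigma_of_lt h, hT.sigma_of_lt (hst.trans_lt h)]
    exact csInf_le_csInf (hT.bddBelow.mono fun s hs => hs.1) ⟨b, hT.right_mem, h⟩
      fun x hx => ⟨hx.1, hst.trans_lt hx.2⟩
  · rw [hT.sigma_of_le h]; exact hT.le_right (hT.sigma_mem s)

theorem exists_gt_of_sigma_eq (hT : IsCompactScale T a b) (h : sigma T t = t) (htb : t < b)
    {x : ℝ} (hx : t < x) : ∃ s ∈ T, t < s ∧ s < x := by
  rw [hT.sigma_of_lt htb] at h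
  obtain ⟨s, hs, hsx⟩ := exists_lt_of_csInf_lt (s := {s | s ∈ T ∧ t < s})
    ⟨b, hT.right_mem, htb⟩ (h.trans_lt hx)
  exact ⟨s, hs.1, hs.2, hsx⟩

theorem rho_of_gt (hT : IsCompactScale T a b) (ht : a < t) :
    rho T t = sSup {s | s ∈ T ∧ s < t} :=
  if_pos ⟨a, hT.left_mem, ht⟩

theorem rho_left (hT : IsCompactScale T a b) : rho T a = a := by
  rw [rho, if_neg, hT.sInf_eq]
  rintro ⟨s, hs, hsa⟩
  exact absurd (hT.left_le hs) (by linarith)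

theorem rho_mem (hT : IsCompactScale T a b) (ht : a ≤ t) : rho T t ∈ T := by
  rcases ht.lt_or_eq with h | rfl
  · rw [hT.rho_of_gt h]
    exact closure_minimal (fun s hs => hs.1) hT.isClosed
      (csSup_mem_closure (s := {s | s ∈ T ∧ s < t}) ⟨a, hT.left_mem, h⟩
        (hT.bddAbove.mono fun s hs => hs.1))
  · rw [hT.rho_left]; exact hT.left_mem

theorem rho_le (hT : IsCompactScale T a b) (ht : a ≤ t) : rho T t ≤ t := by
  rcases ht.lt_or_eq with h | rfl
  · rw [hT.rho_of_gt h]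
    exact csSup_le ⟨a, hT.left_mem, h⟩ fun s hs => hs.2.le
  · exact hT.rho_left.le

theorem le_rho (hT : IsCompactScale T a b) (hs : s ∈ T) (h : s < t) : s ≤ rho T t := by
  rw [hT.rho_of_gt ((hT.left_le hs).trans_lt h)]
  exact le_csSup (hT.bddAbove.mono fun s hs => hs.1) ⟨hs, h⟩

theorem exists_lt_of_rho_eq (hT : IsCompactScale T a b) (h : rho T t = t) (hat : a < t)
    {x : ℝ} (hx : x < t) : ∃ s ∈ T, x < s ∧ s < t := by
  rw [hT.rho_of_gt hat] at h
  obtain ⟨s, hs, hsx⟩ := exists_lt_of_lt_csSup (s := {s | s ∈ T ∧ s < t})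
    ⟨a, hT.left_mem, hat⟩ (hx.trans_eq h.symm)
  exact ⟨s, hs.1, hsx, hs.2⟩

/-- A point with a left gap is the forward jump of its backward jump. -/
theorem sigma_rho (hT : IsCompactScale T a b) (ht : t ∈ T) (h : rho T t < t) :
    sigma T (rho T t) = t := by
  refine le_antisymm (hT.sigma_le ht h) ?_
  by_contra! hlt
  have h1 := hT.le_rho (hT.sigma_mem _) hlt
  have h2 := hT.le_sigma (hT.rho_mem (hT.left_le ht))
  obtain ⟨s, hs, h3, h4⟩ := hT.exists_gt_of_sigma_eq (le_antisymm h1 h2)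
    (h.trans_le (hT.le_right ht)) h
  exact absurd (hT.le_rho hs h4) (by linarith)

theorem mem_kappa (hT : IsCompactScale T a b) : t ∈ kappa T ↔ t ∈ T ∧ t ≤ rho T b := by
  rw [kappa, if_pos hT.bddAbove, hT.sSup_eq]
  constructor
  · rintro ⟨h1, h2⟩
    refine ⟨h1, ?_⟩
    by_contra! h
    exact h2 ⟨h, hT.le_right h1⟩
  · rintro ⟨h1, h2⟩
    exact ⟨h1, fun h => absurd h.1 (by linarith)⟩

theorem kappa_subset (hT : IsCompactScale T a b) : kappa T ⊆ T := fun _ ht => (hT.mem_kappa.1 ht).1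

theorem mem_kappa_of_lt (hT : IsCompactScale T a b) (ht : t ∈ T) (h : t < b) : t ∈ kappa T :=
  hT.mem_kappa.2 ⟨ht, hT.le_rho ht h⟩

theorem rho_eq_of_mem_kappa (hT : IsCompactScale T a b) (h : b ∈ kappa T) : rho T b = b :=
  le_antisymm (hT.rho_le hT.left_le_right) (hT.mem_kappa.1 h).2

theorem kappa_scale (hT : IsCompactScale T a b) : IsCompactScale (kappa T) a (rho T b) where
  isCompact := by
    have : kappa T = T ∩ Iic (rho T b) := by ext t; exact hT.mem_kappa
    rw [this]
    exact hT.isCompact.inter_right isClosed_Iic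
  isLeast := ⟨hT.mem_kappa.2 ⟨hT.left_mem, hT.left_le (hT.rho_mem hT.left_le_right)⟩,
    fun t ht => hT.left_le (hT.kappa_subset ht)⟩
  isGreatest := ⟨hT.mem_kappa.2 ⟨hT.rho_mem hT.left_le_right, le_rfl⟩,
    fun t ht => (hT.mem_kappa.1 ht).2⟩

/-- `T` and `T^κ` agree near the points of `T^κ`. -/
theorem nhdsWithin_kappa (hT : IsCompactScale T a b) (ht : t ∈ kappa T) :
    𝓝[kappa T] t = 𝓝[T] t := by
  refine le_antisymm (nhdsWithin_mono _ hT.kappa_subset) ?_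
  rw [nhdsWithin_le_iff]
  rcases (hT.rho_le hT.left_le_right).lt_or_eq with h | h
  · filter_upwards [self_mem_nhdsWithin,
      mem_nhdsWithin_of_mem_nhds (Iio_mem_nhds ((hT.mem_kappa.1 ht).2.trans_lt h))] with s hs h2
    exact hT.mem_kappa_of_lt hs h2
  · filter_upwards [self_mem_nhdsWithin] with s hs
    exact hT.mem_kappa.2 ⟨hs, (hT.le_right hs).trans_eq h.symm⟩

/-- Removing a left-scattered maximum changes a forward jump only where that jump lands on the
removed point. -/
theorem sigma_kappa (hT : IsCompactScale T a b) (h : sigma T t ∈ kappa T) :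
    sigma (kappa T) t = sigma T t := by
  have hK := hT.kappa_scale
  rcases lt_or_ge t (rho T b) with h1 | h1
  · refine le_antisymm ?_ ?_
    · rcases (hT.le_sigma_of_le (h1.le.trans (hT.rho_le hT.left_le_right))).lt_or_eq with h4 | h4
      · exact hK.sigma_le h h4
      · rw [← h4]
        refine le_of_forall_gt_imp_ge_of_dense fun x hx => ?_
        obtain ⟨s, hs, hs1, hs2⟩ := hT.exists_gt_of_sigma_eq h4.symm
          (h1.trans_le (hT.rho_le hT.left_le_right)) (lt_min hx h1)
        exact (hK.sigma_le (hT.mem_kappa.2 ⟨hs, (hs2.trans_le (min_le_right _ _)).le⟩)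
          hs1).trans (hs2.le.trans (min_le_left _ _))
    · rw [hK.sigma_of_lt h1]
      exact le_csInf ⟨_, hK.right_mem, h1⟩ fun s hs => hT.sigma_le (hT.kappa_subset hs.1) hs.2
  · rw [hK.sigma_of_le h1]
    have h2 := (hT.mem_kappa.1 h).2
    refine le_antisymm ?_ h2
    rcases lt_or_ge t b with h3 | h3
    · exact h1.trans (hT.le_sigma_of_le h3.le)
    · rw [hT.sigma_of_le h3]; exact hT.rho_le hT.left_le_right

/-! ### Delta derivatives -/

/-- The definition allows `s = t`, which forces the difference quotient over the gap. Conversely,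
the error term is continuous in `s` and vanishes at `t`, while `ε * |σ t - s|` stays away from `0`.
-/
theorem hasDeltaDerivAt_iff_of_lt {f : ℝ → ℝ} {d : ℝ} (ht : t ∈ T) (h : t < sigma T t) :
    HasDeltaDerivAt T f d t ↔
      ContinuousWithinAt f T t ∧ f (sigma T t) - f t = d * (sigma T t - t) := by
  set m := sigma T t with hm
  constructor
  · intro H
    have heq : f m - f t = d * (m - t) := by
      have : |f m - f t - d * (m - t)| ≤ 0 := by
        refine le_of_forall_pos_le_add fun ε hε => ?_
        obtain ⟨δ, hδ, H1⟩ := H (ε / (m - t)) (div_pos hε (by linarith))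
        have := H1 t ht (by simpa using hδ)
        rw [← hm, abs_of_pos (show 0 < m - t by linarith),
          div_mul_cancel₀ _ (show m - t ≠ 0 by linarith)] at this
        linarith
      have := abs_eq_zero.1 (le_antisymm this (abs_nonneg _))
      linarith
    refine ⟨?_, heq⟩
    rw [Metric.continuousWithinAt_iff]
    intro ε hε
    obtain ⟨δ, hδ, H1⟩ := H (ε / (2 * (m - t + 1))) (div_pos hε (by linarith))
    have hd : 0 < |d| + 1 := by positivity
    refine ⟨min (min δ 1) (ε / (2 * (|d| + 1))), by positivity, fun {s} hs hst => ?_⟩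
    rw [Real.dist_eq] at hst ⊢
    have h1 : |s - t| < δ := hst.trans_le ((min_le_left _ _).trans (min_le_left _ _))
    have h2 : |s - t| < 1 := hst.trans_le ((min_le_left _ _).trans (min_le_right _ _))
    have h3 : |s - t| < ε / (2 * (|d| + 1)) := hst.trans_le (min_le_right _ _)
    have h4 := H1 s hs h1
    rw [← hm] at h4
    have h5 : |m - s| ≤ m - t + 1 := by
      rw [abs_lt] at h2
      rw [abs_le]; constructor <;> linarith
    have h6 : |f m - f s - d * (m - s)| ≤ ε / 2 := by
      refine h4.trans ((mul_le_mul_of_nonneg_left h5 (by positivity)).trans_eq ?_)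
      have : m - t + 1 ≠ 0 := by linarith
      field_simp
    have h7 : |d * (s - t)| < ε / 2 := by
      rw [abs_mul]
      rw [lt_div_iff₀ (by positivity)] at h3
      nlinarith [abs_nonneg (s - t), abs_nonneg d]
    have h8 : f s - f t = d * (s - t) - (f m - f s - d * (m - s)) := by linear_combination heq
    rw [h8]
    exact (abs_sub _ _).trans_lt (by linarith)
  · rintro ⟨hc, heq⟩ ε hε
    have hc2 : Tendsto (fun s => |f m - f s - d * (m - s)| - ε * |m - s|) (𝓝[T] t)
        (𝓝 (|f m - f t - d * (m - t)| - ε * |m - t|)) := by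
      have hid : Tendsto (fun s : ℝ => s) (𝓝[T] t) (𝓝 t) := tendsto_id.mono_left nhdsWithin_le_nhds
      exact ((tendsto_const_nhds.sub hc).sub
        (tendsto_const_nhds.mul (tendsto_const_nhds.sub hid))).abs.sub
        (tendsto_const_nhds.mul (tendsto_const_nhds.sub hid).abs)
    have hneg : |f m - f t - d * (m - t)| - ε * |m - t| < 0 := by
      rw [heq, sub_self, abs_zero, abs_of_pos (by linarith)]
      nlinarith
    obtain ⟨δ, hδ, H⟩ := Metric.mem_nhdsWithin_iff.1 (hc2.eventually_lt_const hneg)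
    refine ⟨δ, hδ, fun s hs hst => ?_⟩
    have := H ⟨by rwa [Metric.mem_ball, Real.dist_eq], hs⟩
    simp only [mem_ofPred_eq] at this
    linarith

theorem hasDeltaDerivAt_iff_of_eq {f : ℝ → ℝ} {d : ℝ} (h : sigma T t = t) :
    HasDeltaDerivAt T f d t ↔ HasDerivWithinAt f d T t := by
  rw [hasDerivWithinAt_iff_isLittleO, Asymptotics.isLittleO_iff]
  simp only [HasDeltaDerivAt, h, eventually_nhdsWithin_iff, Metric.eventually_nhds_iff,
    Real.dist_eq, Real.norm_eq_abs, smul_eq_mul]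
  have key : ∀ s, |f t - f s - d * (t - s)| = |f s - f t - (s - t) * d| := fun s => by
    rw [← abs_neg]; congr 1; ring
  constructor
  · intro H ε hε
    obtain ⟨δ, hδ, H1⟩ := H ε hε
    exact ⟨δ, hδ, fun {s} hst hs => by rw [← key, abs_sub_comm s t]; exact H1 s hs hst⟩
  · intro H ε hε
    obtain ⟨δ, hδ, H1⟩ := H hε
    exact ⟨δ, hδ, fun s hs hst => by rw [key, abs_sub_comm t s]; exact H1 hst hs⟩

theorem _root_.TimeScale.HasDeltaDerivAt.continuousWithinAt {f : ℝ → ℝ} {d : ℝ}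
    (hT : IsCompactScale T a b) (ht : t ∈ T) (h : HasDeltaDerivAt T f d t) :
    ContinuousWithinAt f T t := by
  rcases (hT.le_sigma ht).lt_or_eq with h1 | h1
  · exact ((hasDeltaDerivAt_iff_of_lt ht h1).1 h).1
  · exact ((hasDeltaDerivAt_iff_of_eq h1.symm).1 h).continuousWithinAt

/-- This is why `T^κ` omits a left-scattered maximum: a point of `T^κ` with `σ t = t` is
right-dense, or is a left-dense `b`. Uniqueness of the derivative follows. -/
theorem accPt_of_sigma_eq (hT : IsCompactScale T a b) (hab : a < b) (ht : t ∈ kappa T)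
    (h : sigma T t = t) : AccPt t (𝓟 T) := by
  rw [accPt_iff_nhds]
  intro U hU
  obtain ⟨δ, hδ, hU⟩ := Metric.mem_nhds_iff.1 hU
  rcases (hT.le_right (hT.kappa_subset ht)).lt_or_eq with h1 | rfl
  · obtain ⟨s, hs, h2, h3⟩ := hT.exists_gt_of_sigma_eq h h1 (show t < t + δ by linarith)
    exact ⟨s, ⟨hU (by rw [Metric.mem_ball, Real.dist_eq, abs_lt]; constructor <;> linarith), hs⟩,
      h2.ne'⟩
  · obtain ⟨s, hs, h2, h3⟩ := hT.exists_lt_of_rho_eq (hT.rho_eq_of_mem_kappa ht) hab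
      (show t - δ < t by linarith)
    exact ⟨s, ⟨hU (by rw [Metric.mem_ball, Real.dist_eq, abs_lt]; constructor <;> linarith), hs⟩,
      h3.ne⟩

theorem hasDeltaDerivAt_unique (hT : IsCompactScale T a b) (hab : a < b) (ht : t ∈ kappa T)
    {f : ℝ → ℝ} {d d' : ℝ} (h : HasDeltaDerivAt T f d t) (h' : HasDeltaDerivAt T f d' t) :
    d = d' := by
  have htT := hT.kappa_subset ht
  rcases (hT.le_sigma htT).lt_or_eq with h1 | h1
  · have h2 := ((hasDeltaDerivAt_iff_of_lt htT h1).1 h).2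
    have h3 := ((hasDeltaDerivAt_iff_of_lt htT h1).1 h').2
    exact mul_right_cancel₀ (show sigma T t - t ≠ 0 by linarith) (h2.symm.trans h3)
  · have hu : UniqueDiffWithinAt ℝ T t :=
      uniqueDiffWithinAt_iff_accPt.2 (hT.accPt_of_sigma_eq hab ht h1.symm)
    exact hu.eq_deriv _ ((hasDeltaDerivAt_iff_of_eq h1.symm).1 h)
      ((hasDeltaDerivAt_iff_of_eq h1.symm).1 h')

theorem _root_.TimeScale.DeltaDifferentiableAt.hasDeltaDerivAt {f : ℝ → ℝ}
    (h : DeltaDifferentiableAt T f t) : HasDeltaDerivAt T f (deltaDeriv T f t) t := by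
  rw [deltaDeriv, dif_pos h]; exact h.choose_spec

theorem deltaDeriv_eq (hT : IsCompactScale T a b) (hab : a < b) (ht : t ∈ kappa T)
    {f : ℝ → ℝ} {d : ℝ} (h : HasDeltaDerivAt T f d t) : deltaDeriv T f t = d :=
  hT.hasDeltaDerivAt_unique hab ht (DeltaDifferentiableAt.hasDeltaDerivAt ⟨d, h⟩) h

/-- The only point of `T` that can lie outside `T^κ` is an isolated maximum, where continuity is
automatic. -/
theorem continuousOn_of_deltaDeriv (hT : IsCompactScale T a b) {f f' : ℝ → ℝ}
    (h : ∀ t ∈ kappa T, HasDeltaDerivAt T f (f' t) t) : ContinuousOn f T := by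
  intro t ht
  by_cases htk : t ∈ kappa T
  · exact (h t htk).continuousWithinAt hT ht
  · have h1 : t = b := by
      by_contra hne
      exact htk (hT.mem_kappa_of_lt ht (lt_of_le_of_ne (hT.le_right ht) hne))
    subst h1
    have h2 : rho T t < t := by
      by_contra! h2
      exact htk (hT.mem_kappa.2 ⟨ht, h2⟩)
    have h3 : 𝓝[T] t ≤ pure t := by
      rw [le_pure_iff]
      filter_upwards [self_mem_nhdsWithin, mem_nhdsWithin_of_mem_nhds (Ioi_mem_nhds h2)]
        with s hs hs2
      by_contra hne
      exact absurd (hT.le_rho hs (lt_of_le_of_ne (hT.le_right hs) hne)) (not_le.2 hs2)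
    exact (tendsto_pure_nhds f t).mono_left h3

/-! ### Monotonicity and uniqueness of antiderivatives. -/

/-- A function on a compact time scale that is continuous and does not decrease
infinitesimally does not decrease. -/
theorem le_of_forall_exists_gt (hT : IsCompactScale T a b) {f : ℝ → ℝ} {u w : ℝ} (hu : u ∈ T)
    (huw : u ≤ w) (hf : ContinuousOn f (T ∩ Icc u w))
    (H : ∀ x ∈ T, u ≤ x → x < w → ∀ ε > 0, ∃ y ∈ T, x < y ∧ y ≤ w ∧ f x - ε * (y - x) ≤ f y) :
    f u ≤ f w := by
  refine le_of_forall_pos_le_add fun ε' hε' => ?_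
  -- The `+ 1` keeps the denominator positive when `u = w`.
  set ε := ε' / (w - u + 1) with hε_def
  have hε : 0 < ε := div_pos hε' (by linarith)
  -- Continuous induction: `A` is compact, and `H` moves any point of `A` before `w` further right
  -- inside `A`, so its greatest point is `w`.
  set A : Set ℝ := {x | x ∈ T ∩ Icc u w ∧ f u ≤ f x + ε * (x - u)} with hA
  have hTc : IsClosed (T ∩ Icc u w) := hT.isClosed.inter isClosed_Icc
  have hcont : ContinuousOn (fun x => f x + ε * (x - u)) (T ∩ Icc u w) := by fun_prop
  have hAc : IsClosed A := by
    have := hcont.preimage_isClosed_of_isClosed hTc (isClosed_Ici (a := f u))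
    exact this
  have hAcomp : IsCompact A := hT.isCompact.of_isClosed_subset hAc fun x hx => hx.1.1
  have hAne : A.Nonempty := ⟨u, ⟨hu, le_rfl, huw⟩, by simp⟩
  obtain ⟨hm, hmax⟩ := hAcomp.isGreatest_sSup hAne
  set m := sSup A
  have hmw : m = w := by
    by_contra hne
    have hlt : m < w := lt_of_le_of_ne hm.1.2.2 hne
    obtain ⟨y, hy, hmy, hyw, hfy⟩ := H m hm.1.1 hm.1.2.1 hlt ε hε
    have : y ∈ A := ⟨⟨hy, hm.1.2.1.trans hmy.le, hyw⟩, by linarith [hm.2]⟩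
    exact absurd (hmax this) (by linarith)
  have h1 := hm.2
  rw [hmw] at h1
  have h2 : ε * (w - u) ≤ ε' := by
    rw [hε_def, div_mul_eq_mul_div, div_le_iff₀ (by linarith)]
    nlinarith
  linarith

theorem exists_gt_of_deltaDeriv_nonneg (hT : IsCompactScale T a b) {f : ℝ → ℝ} {d x w : ℝ}
    (hx : x ∈ T) (hw : w ∈ T) (hxw : x < w) (hd : 0 ≤ d) (h : HasDeltaDerivAt T f d x) {ε : ℝ}
    (hε : 0 < ε) : ∃ y ∈ T, x < y ∧ y ≤ w ∧ f x - ε * (y - x) ≤ f y := by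
  rcases (hT.le_sigma hx).lt_or_eq with h1 | h1
  · refine ⟨sigma T x, hT.sigma_mem x, h1, hT.sigma_le hw hxw, ?_⟩
    have := ((hasDeltaDerivAt_iff_of_lt hx h1).1 h).2
    nlinarith [mul_nonneg hd (sub_nonneg.2 h1.le), mul_nonneg hε.le (sub_nonneg.2 h1.le)]
  · obtain ⟨δ, hδ, H⟩ := h ε hε
    obtain ⟨y, hy, h2, h3⟩ := hT.exists_gt_of_sigma_eq h1.symm (hxw.trans_le (hT.le_right hw))
      (lt_min (show x < x + δ by linarith) hxw)
    have h4 : y < x + δ := h3.trans_le (min_le_left _ _)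
    refine ⟨y, hy, h2, h3.le.trans (min_le_right _ _), ?_⟩
    have h5 := H y hy (by rw [abs_of_pos] <;> linarith)
    rw [← h1, abs_sub_comm x y, abs_of_pos (show 0 < y - x by linarith)] at h5
    have h6 := (abs_le.1 h5).2
    nlinarith [mul_nonneg hd (sub_nonneg.2 h2.le)]

theorem le_of_deltaDeriv_nonneg (hT : IsCompactScale T a b) {f f' : ℝ → ℝ}
    (h : ∀ t ∈ kappa T, HasDeltaDerivAt T f (f' t) t) (h0 : ∀ t ∈ kappa T, 0 ≤ f' t) {u w : ℝ}
    (hu : u ∈ T) (hw : w ∈ T) (huw : u ≤ w) : f u ≤ f w :=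
  hT.le_of_forall_exists_gt hu huw
    ((hT.continuousOn_of_deltaDeriv h).mono inter_subset_left) fun x hx _ hxw _ hε =>
    have hk := hT.mem_kappa_of_lt hx (hxw.trans_le (hT.le_right hw))
    hT.exists_gt_of_deltaDeriv_nonneg hx hw hxw (h0 x hk) (h x hk) hε

theorem _root_.TimeScale.HasDeltaDerivAt.sub {f g : ℝ → ℝ} {d e : ℝ}
    (hf : HasDeltaDerivAt T f d t) (hg : HasDeltaDerivAt T g e t) :
    HasDeltaDerivAt T (fun x => f x - g x) (d - e) t := by
  intro ε hε
  obtain ⟨δ, hδ, H⟩ := hf (ε / 2) (by positivity)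
  obtain ⟨δ', hδ', H'⟩ := hg (ε / 2) (by positivity)
  refine ⟨min δ δ', by positivity, fun s hs hst => ?_⟩
  have h1 := H s hs (hst.trans_le (min_le_left _ _))
  have h2 := H' s hs (hst.trans_le (min_le_right _ _))
  set m := sigma T t
  have : f m - g m - (f s - g s) - (d - e) * (m - s)
      = (f m - f s - d * (m - s)) - (g m - g s - e * (m - s)) := by ring
  rw [this]
  exact (abs_sub _ _).trans (by linarith)

theorem _root_.TimeScale.HasDeltaDerivAt.const_mul {f : ℝ → ℝ} {d : ℝ} (c : ℝ)
    (hf : HasDeltaDerivAt T f d t) : HasDeltaDerivAt T (fun x => c * f x) (c * d) t := by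
  intro ε hε
  obtain ⟨δ, hδ, H⟩ := hf (ε / (|c| + 1)) (by positivity)
  refine ⟨δ, hδ, fun s hs hst => ?_⟩
  have h1 := H s hs hst
  set m := sigma T t
  have : c * f m - c * f s - c * d * (m - s) = c * (f m - f s - d * (m - s)) := by ring
  rw [this, abs_mul]
  calc |c| * |f m - f s - d * (m - s)| ≤ |c| * (ε / (|c| + 1) * |m - s|) := by gcongr
    _ ≤ (|c| + 1) * (ε / (|c| + 1) * |m - s|) := by gcongr; linarith
    _ = ε * |m - s| := by field_simp

/-- Lets the outer derivative in `y^{ΔΔ}`, taken on `T^κ`, be combined with derivatives taken on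
`T`. -/
theorem hasDeltaDerivAt_kappa_iff (hT : IsCompactScale T a b) (ht : t ∈ kappa T)
    (h : sigma T t ∈ kappa T) {f : ℝ → ℝ} {d : ℝ} :
    HasDeltaDerivAt (kappa T) f d t ↔ HasDeltaDerivAt T f d t := by
  have hs := hT.sigma_kappa h
  have htT := hT.kappa_subset ht
  rcases (hT.le_sigma htT).lt_or_eq with h1 | h1
  · rw [hasDeltaDerivAt_iff_of_lt ht (by rwa [hs]), hasDeltaDerivAt_iff_of_lt htT h1, hs,
      ContinuousWithinAt, ContinuousWithinAt, hT.nhdsWithin_kappa ht]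
  · rw [hasDeltaDerivAt_iff_of_eq (by rw [hs, ← h1]), hasDeltaDerivAt_iff_of_eq h1.symm,
      hasDerivWithinAt_iff_isLittleO, hasDerivWithinAt_iff_isLittleO, hT.nhdsWithin_kappa ht]

/-- Two antiderivatives of the same function differ by a constant. -/
theorem antiderivative_sub_eq (hT : IsCompactScale T a b) {f F G : ℝ → ℝ}
    (hF : IsAntiderivative T f F) (hG : IsAntiderivative T f G) {u w : ℝ} (hu : u ∈ T) (hw : w ∈ T)
    (huw : u ≤ w) : F w - F u = G w - G u := by
  have h1 := hT.le_of_deltaDeriv_nonneg (f' := fun t => f t - f t)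
    (fun t ht => (hF t ht).sub (hG t ht)) (fun t _ => by simp) hu hw huw
  have h2 := hT.le_of_deltaDeriv_nonneg (f' := fun t => f t - f t)
    (fun t ht => (hG t ht).sub (hF t ht)) (fun t _ => by simp) hu hw huw
  linarith

theorem deltaIntegral_eq (hT : IsCompactScale T a b) {f F : ℝ → ℝ} (hF : IsAntiderivative T f F) :
    deltaIntegral T a b f = F b - F a := by
  have h : ∃ F, IsAntiderivative T f F := ⟨F, hF⟩
  rw [deltaIntegral, dif_pos h]
  exact hT.antiderivative_sub_eq h.choose_spec hF hT.left_mem hT.right_mem hT.left_le_right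

end IsCompactScale

/-! ### Step extensions and the construction of antiderivatives. -/

/-- The greatest point of `T` that does not exceed `s` (and `a` for `s < a`), where `a = min T`. -/
noncomputable def floor (T : Set ℝ) (a s : ℝ) : ℝ := sSup (T ∩ Iic (max a s))

/-- The forward jump of the greatest point of `T` that does not exceed `s`. -/
noncomputable def ceil (T : Set ℝ) (a s : ℝ) : ℝ := sigma T (floor T a s)

/-- The integral from `a` to `t` of the step extension of `x ↦ h (x, σ x)`. -/
noncomputable def primitive (T : Set ℝ) (a : ℝ) (h : ℝ × ℝ → ℝ) (t : ℝ) : ℝ :=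
  ∫ s in a..t, h (floor T a s, ceil T a s)

namespace IsCompactScale

theorem isGreatest_floor (hT : IsCompactScale T a b) (s : ℝ) :
    IsGreatest (T ∩ Iic (max a s)) (floor T a s) :=
  (hT.isCompact.inter_right isClosed_Iic).isGreatest_sSup
    ⟨a, hT.left_mem, mem_Iic.2 (le_max_left _ _)⟩

theorem floor_mem (hT : IsCompactScale T a b) (s : ℝ) : floor T a s ∈ T :=
  (hT.isGreatest_floor s).1.1

theorem floor_le (hT : IsCompactScale T a b) (hs : a ≤ s) : floor T a s ≤ s := by
  simpa [hs] using (hT.isGreatest_floor s).1.2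

theorem le_floor (hT : IsCompactScale T a b) (ht : t ∈ T) (h : t ≤ s) : t ≤ floor T a s :=
  (hT.isGreatest_floor s).2 ⟨ht, h.trans (le_max_right _ _)⟩

theorem floor_mono (hT : IsCompactScale T a b) : Monotone (floor T a) := fun s t hst =>
  (hT.isGreatest_floor t).2
    ⟨hT.floor_mem s, (hT.isGreatest_floor s).1.2.trans (max_le_max le_rfl hst)⟩

theorem ceil_mono (hT : IsCompactScale T a b) : Monotone (ceil T a) :=
  hT.sigma_mono.comp hT.floor_mono

theorem ceil_mem (hT : IsCompactScale T a b) (s : ℝ) : ceil T a s ∈ T := hT.sigma_mem _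

theorem ceil_le (hT : IsCompactScale T a b) (ht : t ∈ T) (hs : a ≤ s) (h : s < t) :
    ceil T a s ≤ t :=
  hT.sigma_le ht ((hT.floor_le hs).trans_lt h)

theorem le_ceil (hT : IsCompactScale T a b) (hs : s ≤ b) : s ≤ ceil T a s := by
  by_contra! h
  have h1 : ceil T a s ≤ floor T a s := hT.le_floor (hT.ceil_mem s) h.le
  have h2 : sigma T (floor T a s) = floor T a s := le_antisymm h1 (hT.le_sigma (hT.floor_mem s))
  have h3 : floor T a s < s := by rw [ceil, h2] at h; exact h
  obtain ⟨x, hx, h4, h5⟩ := hT.exists_gt_of_sigma_eq h2 (h3.trans_le hs) h3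
  exact absurd (hT.le_floor hx h5.le) (by linarith)

theorem floor_mem_Ico (hT : IsCompactScale T a b) {u w : ℝ} (hu : u ∈ T) (hs : s ∈ Ico u w) :
    floor T a s ∈ Ico u w :=
  ⟨hT.le_floor hu hs.1, (hT.floor_le ((hT.left_le hu).trans hs.1)).trans_lt hs.2⟩

/-- Together with `tendsto_sigma_left` this replaces continuity of `σ`, which can fail at
right-scattered points. -/
theorem continuousWithinAt_sigma (hT : IsCompactScale T a b) (ht : t ∈ T) (h : sigma T t = t) :
    Tendsto (sigma T) (𝓝[T] t) (𝓝 t) := by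
  rw [tendsto_order]
  constructor
  · intro x hx
    filter_upwards [self_mem_nhdsWithin, mem_nhdsWithin_of_mem_nhds (Ioi_mem_nhds hx)] with s hs h2
    exact h2.trans_le (hT.le_sigma hs)
  · intro x hx
    rcases (hT.le_right ht).lt_or_eq with htb | rfl
    · obtain ⟨y, hy, h1, h2⟩ := hT.exists_gt_of_sigma_eq h htb hx
      filter_upwards [mem_nhdsWithin_of_mem_nhds (Iio_mem_nhds h1)] with s hs
      exact (hT.sigma_le hy hs).trans_lt h2
    · exact Eventually.of_forall fun s => (hT.le_right (hT.sigma_mem s)).trans_lt hx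

theorem tendsto_sigma_left (hT : IsCompactScale T a b) (ht : t ∈ T) :
    Tendsto (sigma T) (𝓝[T ∩ Iio t] t) (𝓝 t) := by
  refine tendsto_of_tendsto_of_tendsto_of_le_of_le' (tendsto_id.mono_left nhdsWithin_le_nhds)
    tendsto_const_nhds ?_ ?_
  · filter_upwards [self_mem_nhdsWithin] with s hs using hT.le_sigma hs.1
  · filter_upwards [self_mem_nhdsWithin] with s hs using hT.sigma_le ht hs.2

/-- `floor` and `ceil` are monotone, hence measurable, and take values in the compact set `T`, so
the integrand is measurable and bounded. -/
theorem intervalIntegrable_step (hT : IsCompactScale T a b) {h : ℝ × ℝ → ℝ} (hh : Continuous h)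
    (x y : ℝ) : IntervalIntegrable (fun s => h (floor T a s, ceil T a s)) volume x y := by
  obtain ⟨M, hM⟩ := (hT.isCompact.prod hT.isCompact).exists_bound_of_continuousOn hh.continuousOn
  have hmeas : Measurable fun s => h (floor T a s, ceil T a s) :=
    hh.measurable.comp (hT.floor_mono.measurable.prodMk hT.ceil_mono.measurable)
  rw [intervalIntegrable_iff]
  exact Measure.integrableOn_of_bounded (M := M) (by simp) hmeas.aestronglyMeasurable
    (Eventually.of_forall fun s => hM _ ⟨hT.floor_mem s, hT.ceil_mem s⟩)

theorem primitive_sub (hT : IsCompactScale T a b) {h : ℝ × ℝ → ℝ} (hh : Continuous h) (x y : ℝ) :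
    primitive T a h y - primitive T a h x = ∫ s in x..y, h (floor T a s, ceil T a s) :=
  intervalIntegral.integral_interval_sub_left (hT.intervalIntegrable_step hh _ _)
    (hT.intervalIntegrable_step hh _ _)

theorem primitive_left {h : ℝ × ℝ → ℝ} : primitive T a h a = 0 := by simp [primitive]

theorem continuous_primitive (hT : IsCompactScale T a b) {h : ℝ × ℝ → ℝ} (hh : Continuous h) :
    Continuous (primitive T a h) :=
  intervalIntegral.continuous_primitive (fun x y => hT.intervalIntegrable_step hh x y) a

/-- For `s` in `[u, w)` the floor of `s` is a point of `T` in `[u, w)`, so the step integrand is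
within `ε` of `l`; the point `s = w` is a null set. This one estimate serves for gaps, dense points
and left derivatives. -/
theorem abs_primitive_sub_le (hT : IsCompactScale T a b) {h : ℝ × ℝ → ℝ} (hh : Continuous h)
    {u w l ε : ℝ} (hu : u ∈ T) (huw : u ≤ w)
    (H : ∀ x ∈ T, u ≤ x → x < w → |h (x, sigma T x) - l| ≤ ε) :
    |primitive T a h w - primitive T a h u - l * (w - u)| ≤ ε * (w - u) := by
  have h1 : primitive T a h w - primitive T a h u - l * (w - u)
      = ∫ s in u..w, (h (floor T a s, ceil T a s) - l) := by
    rw [intervalIntegral.integral_sub (hT.intervalIntegrable_step hh _ _) (by simp),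
      hT.primitive_sub hh]
    simp [mul_comm]
  rw [h1, ← abs_of_nonneg (sub_nonneg.2 huw), ← Real.norm_eq_abs]
  refine intervalIntegral.norm_integral_le_of_norm_le_const_ae ?_
  have hne : ∀ᵐ s : ℝ, s ≠ w := by simp [ae_iff]
  filter_upwards [hne] with s hsw hs
  rw [uIoc_of_le huw] at hs
  have h2 := hT.floor_mem_Ico hu (w := w) (s := s) ⟨hs.1.le, lt_of_le_of_ne hs.2 hsw⟩
  exact H _ (hT.floor_mem s) h2.1 h2.2

theorem hasDeltaDerivAt_primitive (hT : IsCompactScale T a b) {h : ℝ × ℝ → ℝ} (hh : Continuous h)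
    (ht : t ∈ T) : HasDeltaDerivAt T (primitive T a h) (h (t, sigma T t)) t := by
  rcases (hT.le_sigma ht).lt_or_eq with h1 | h1
  · rw [hasDeltaDerivAt_iff_of_lt ht h1]
    refine ⟨(hT.continuous_primitive hh).continuousWithinAt, ?_⟩
    -- `t` is the only point of `T` in `[t, σ t)`, so no error is left.
    have := hT.abs_primitive_sub_le hh (l := h (t, sigma T t)) (ε := 0) ht h1.le
      fun x hx h2 h3 => by
        have : x = t := by
          by_contra hne
          exact absurd (hT.sigma_le hx (lt_of_le_of_ne h2 (Ne.symm hne))) (by linarith)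
        simp [this]
    rw [zero_mul] at this
    linarith [abs_eq_zero.1 (le_antisymm this (abs_nonneg _))]
  · intro ε hε
    have hc : Tendsto (fun x => h (x, sigma T x)) (𝓝[T] t) (𝓝 (h (t, t))) :=
      (hh.tendsto (t, t)).comp ((tendsto_id.mono_left nhdsWithin_le_nhds).prodMk_nhds
        (hT.continuousWithinAt_sigma ht h1.symm))
    obtain ⟨δ, hδ, H⟩ := Metric.mem_nhdsWithin_iff.1
      (hc (Metric.closedBall_mem_nhds _ hε))
    have H' : ∀ x ∈ T, |x - t| < δ → |h (x, sigma T x) - h (t, t)| ≤ ε := fun x hx hxt =>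
      H ⟨by rwa [Metric.mem_ball, Real.dist_eq], hx⟩
    refine ⟨δ, hδ, fun s hs hst => ?_⟩
    rw [← h1]
    rw [abs_lt] at hst
    rcases le_total s t with h2 | h2
    · rw [abs_of_nonneg (sub_nonneg.2 h2)]
      refine hT.abs_primitive_sub_le hh hs h2 fun x hx h3 h4 => H' x hx ?_
      rw [abs_lt]; constructor <;> linarith
    · rw [abs_sub_comm t s, abs_of_nonneg (sub_nonneg.2 h2), ← abs_neg]
      have := hT.abs_primitive_sub_le hh (l := h (t, t)) (ε := ε) ht h2 fun x hx h3 h4 =>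
        H' x hx (by rw [abs_lt]; constructor <;> linarith)
      convert this using 2
      ring

theorem isAntiderivative_primitive (hT : IsCompactScale T a b) {h : ℝ × ℝ → ℝ} (hh : Continuous h) :
    IsAntiderivative T (fun t => h (t, sigma T t)) (primitive T a h) :=
  fun _ ht => hT.hasDeltaDerivAt_primitive hh (hT.kappa_subset ht)

/-- The left derivative of a primitive. -/
theorem hasDerivWithinAt_primitive_left (hT : IsCompactScale T a b) {h : ℝ × ℝ → ℝ}
    (hh : Continuous h) (ht : t ∈ T) :
    HasDerivWithinAt (primitive T a h) (h (t, t)) (T ∩ Iic t) t := by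
  have hc : Tendsto (fun x => h (x, sigma T x)) (𝓝[T ∩ Iio t] t) (𝓝 (h (t, t))) :=
    (hh.tendsto (t, t)).comp ((tendsto_id.mono_left nhdsWithin_le_nhds).prodMk_nhds
      (hT.tendsto_sigma_left ht))
  rw [hasDerivWithinAt_iff_isLittleO, Asymptotics.isLittleO_iff]
  intro ε hε
  obtain ⟨δ, hδ, H⟩ := Metric.mem_nhdsWithin_iff.1 (hc (Metric.closedBall_mem_nhds _ hε))
  filter_upwards [self_mem_nhdsWithin, mem_nhdsWithin_of_mem_nhds (Metric.ball_mem_nhds t hδ)]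
    with s hs hst
  rw [Metric.mem_ball, Real.dist_eq, abs_lt] at hst
  have hle : s ≤ t := hs.2
  have := hT.abs_primitive_sub_le hh (l := h (t, t)) (ε := ε) hs.1 hle fun x hx h3 h4 =>
    H ⟨by rw [Metric.mem_ball, Real.dist_eq, abs_lt]; constructor <;> linarith, hx, h4⟩
  rw [Real.norm_eq_abs, Real.norm_eq_abs, abs_sub_comm s t, abs_of_nonneg (sub_nonneg.2 hle),
    ← abs_neg]
  convert this using 2
  simp only [smul_eq_mul]
  ring

/-- A function continuous on a compact time scale extends to a continuous function on `ℝ`. -/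
theorem exists_continuous_eqOn (hT : IsCompactScale T a b) {f : ℝ → ℝ} (hf : ContinuousOn f T) :
    ∃ g : ℝ → ℝ, Continuous g ∧ EqOn f g T := by
  obtain ⟨g, -, hg⟩ := ContinuousMap.exists_restrict_eq_forall_mem_of_closed
    ⟨T.domRestrict f, hf.domRestrict⟩ (t := univ) (fun _ => mem_univ _) ⟨0, mem_univ _⟩ hT.isClosed
  exact ⟨g, g.continuous, fun x hx => (congrArg (fun k : C(T, ℝ) => k ⟨x, hx⟩) hg).symm⟩

end IsCompactScale

/-! ### Volterra operators and their inversion. -/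

/-- The iterated integral `∫_a^t ∫_a^s p y^σ`. -/
noncomputable def volterra (T : Set ℝ) (a : ℝ) (p y : ℝ → ℝ) (t : ℝ) : ℝ :=
  primitive T a (fun z => primitive T a (fun w => p w.1 * y w.2) z.1) t

namespace IsCompactScale

theorem primitive_add (hT : IsCompactScale T a b) {g h : ℝ × ℝ → ℝ} (hg : Continuous g)
    (hh : Continuous h) (t : ℝ) :
    primitive T a (fun w => g w + h w) t = primitive T a g t + primitive T a h t :=
  intervalIntegral.integral_add (hT.intervalIntegrable_step hg _ _)
    (hT.intervalIntegrable_step hh _ _)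

theorem _root_.TimeScale.primitive_const_mul (c : ℝ) (g : ℝ × ℝ → ℝ) (t : ℝ) :
    primitive T a (fun w => c * g w) t = c * primitive T a g t :=
  intervalIntegral.integral_const_mul _ _

theorem continuous_volterra (hT : IsCompactScale T a b) {p y : ℝ → ℝ} (hp : Continuous p)
    (hy : Continuous y) : Continuous (volterra T a p y) :=
  hT.continuous_primitive ((hT.continuous_primitive (by fun_prop)).comp continuous_fst)

theorem volterra_add_right (hT : IsCompactScale T a b) {p y z : ℝ → ℝ} (hp : Continuous p)
    (hy : Continuous y) (hz : Continuous z) (t : ℝ) :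
    volterra T a p (fun x => y x + z x) t = volterra T a p y t + volterra T a p z t := by
  have hP : ∀ y : ℝ → ℝ, Continuous y → Continuous (primitive T a fun w => p w.1 * y w.2) :=
    fun y hy => hT.continuous_primitive (by fun_prop)
  have h1 : ∀ x, primitive T a (fun w => p w.1 * (y w.2 + z w.2)) x
      = primitive T a (fun w => p w.1 * y w.2) x + primitive T a (fun w => p w.1 * z w.2) x := by
    intro x
    simp only [mul_add]
    exact hT.primitive_add (by fun_prop) (by fun_prop) x
  simp only [volterra, h1]
  exact hT.primitive_add ((hP y hy).comp continuous_fst) ((hP z hz).comp continuous_fst) t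

theorem volterra_add_left (hT : IsCompactScale T a b) {p q y : ℝ → ℝ} (hp : Continuous p)
    (hq : Continuous q) (hy : Continuous y) (t : ℝ) :
    volterra T a (fun x => p x + q x) y t = volterra T a p y t + volterra T a q y t := by
  have hP : ∀ p : ℝ → ℝ, Continuous p → Continuous (primitive T a fun w => p w.1 * y w.2) :=
    fun p hp => hT.continuous_primitive (by fun_prop)
  have h1 : ∀ x, primitive T a (fun w => (p w.1 + q w.1) * y w.2) x
      = primitive T a (fun w => p w.1 * y w.2) x + primitive T a (fun w => q w.1 * y w.2) x := by
    intro x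
    simp only [add_mul]
    exact hT.primitive_add (by fun_prop) (by fun_prop) x
  simp only [volterra, h1]
  exact hT.primitive_add ((hP p hp).comp continuous_fst) ((hP q hq).comp continuous_fst) t

theorem _root_.TimeScale.volterra_const_mul (c : ℝ) (p y : ℝ → ℝ) (t : ℝ) :
    volterra T a p (fun x => c * y x) t = c * volterra T a p y t := by
  have h1 : ∀ x, primitive T a (fun w => p w.1 * (c * y w.2)) x
      = c * primitive T a (fun w => p w.1 * y w.2) x := by
    intro x
    rw [← primitive_const_mul]
    congr 1; ext w; ring
  simp only [volterra, h1]
  exact primitive_const_mul _ _ _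

theorem _root_.TimeScale.volterra_const_left (c : ℝ) (y : ℝ → ℝ) (t : ℝ) :
    volterra T a (fun _ => c) y t = c * volterra T a (fun _ => 1) y t := by
  simp only [volterra, primitive_const_mul, one_mul]

theorem abs_primitive_le (hT : IsCompactScale T a b) {p y : ℝ → ℝ} {M B : ℝ} (hM0 : 0 ≤ M)
    (hM : ∀ x ∈ T, |p x| ≤ M) (ht : t ∈ T) (hB : ∀ x ∈ T, x ≤ t → |y x| ≤ B) :
    |primitive T a (fun w => p w.1 * y w.2) t| ≤ M * B * (t - a) := by
  rw [← abs_of_nonneg (sub_nonneg.2 (hT.left_le ht)), ← Real.norm_eq_abs, primitive]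
  refine intervalIntegral.norm_integral_le_of_norm_le_const_ae ?_
  have hne : ∀ᵐ s : ℝ, s ≠ t := by simp [ae_iff]
  filter_upwards [hne] with s hst hs
  rw [uIoc_of_le (hT.left_le ht)] at hs
  rw [norm_mul]
  exact mul_le_mul (hM _ (hT.floor_mem s)) (hB _ (hT.ceil_mem s)
    (hT.ceil_le ht hs.1.le (lt_of_le_of_ne hs.2 hst))) (norm_nonneg _) hM0

/-- The factor `1 / K` comes from the outer integral alone, whose argument `floor s ≤ s` respects
the weight. The inner one evaluates `y` at `ceil s`, which may lie well beyond `s`, so it is bounded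
crudely by the length `b - a`. -/
theorem abs_volterra_le (hT : IsCompactScale T a b) {p y : ℝ → ℝ} {M B K : ℝ} (hM0 : 0 ≤ M)
    (hB0 : 0 ≤ B) (hK : 0 < K) (hM : ∀ x ∈ T, |p x| ≤ M)
    (hB : ∀ x ∈ T, |y x| ≤ B * Real.exp (K * (x - a))) (ht : t ∈ Icc a b) :
    |volterra T a p y t| ≤ M * (b - a) / K * (B * Real.exp (K * (t - a))) := by
  have hab := hT.left_le_right
  have hS : ∀ x ∈ T, |primitive T a (fun w => p w.1 * y w.2) x|
      ≤ M * (b - a) * B * Real.exp (K * (x - a)) := by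
    intro x hx
    refine (hT.abs_primitive_le (B := B * Real.exp (K * (x - a))) hM0 hM hx fun z hz hzx =>
      (hB z hz).trans (by gcongr)).trans ?_
    have h1 := hT.le_right hx
    have h2 : 0 ≤ M * (B * Real.exp (K * (x - a))) := by positivity
    calc M * (B * Real.exp (K * (x - a))) * (x - a)
        ≤ M * (B * Real.exp (K * (x - a))) * (b - a) := by gcongr
      _ = _ := by ring
  have hbd : |volterra T a p y t| ≤ ∫ s in a..t, M * (b - a) * B * Real.exp (K * (s - a)) := by
    rw [volterra, primitive, ← Real.norm_eq_abs]
    refine intervalIntegral.norm_integral_le_of_norm_le ht.1 ?_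
      (Continuous.intervalIntegrable (by fun_prop) _ _)
    refine Eventually.of_forall fun s hs => (hS _ (hT.floor_mem s)).trans ?_
    have := hT.floor_le hs.1.le
    have h3 : 0 ≤ b - a := sub_nonneg.2 hab
    gcongr
  have hint : ∫ s in a..t, M * (b - a) * B * Real.exp (K * (s - a))
      = M * (b - a) * B * Real.exp (K * (t - a)) / K - M * (b - a) * B / K := by
    rw [intervalIntegral.integral_eq_sub_of_hasDerivAt
      (f := fun s => M * (b - a) * B * Real.exp (K * (s - a)) / K)]
    · simp
    · intro x _
      have h1 : HasDerivAt (fun s => K * (s - a)) K x := by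
        simpa using ((hasDerivAt_id x).sub_const a).const_mul K
      have := (h1.exp.const_mul (M * (b - a) * B)).div_const K
      rwa [← mul_assoc, mul_div_cancel_right₀ _ hK.ne'] at this
    · exact Continuous.intervalIntegrable (by fun_prop) _ _
  rw [hint] at hbd
  have h4 : 0 ≤ M * (b - a) * B / K := by
    have h3 : 0 ≤ b - a := sub_nonneg.2 hab
    positivity
  calc _ ≤ _ := hbd
    _ ≤ M * (b - a) * B * Real.exp (K * (t - a)) / K := by linarith
    _ = _ := by ring

end IsCompactScale

/-- A bounded operator on `C([a, b])` of Volterra type: it contracts the norms with weight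
`exp (K (t - a))` at the rate `C / K`. -/
def IsVolterra {a b : ℝ} (C : ℝ) (L : C(Icc a b, ℝ) →L[ℝ] C(Icc a b, ℝ)) : Prop :=
  ∀ K > 0, ∀ B ≥ 0, ∀ z : C(Icc a b, ℝ), (∀ t, |z t| ≤ B * Real.exp (K * (t - a))) →
    ∀ t, |L z t| ≤ C / K * (B * Real.exp (K * (t - a)))

namespace IsVolterra

variable {a b C D : ℝ} {L M : C(Icc a b, ℝ) →L[ℝ] C(Icc a b, ℝ)}

theorem add (hL : IsVolterra C L) (hM : IsVolterra D M) : IsVolterra (C + D) (L + M) := by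
  intro K hK B hB z hz t
  rw [add_div, add_mul]
  exact (abs_add_le _ _).trans (add_le_add (hL K hK B hB z hz t) (hM K hK B hB z hz t))

theorem smul (hL : IsVolterra C L) (c : ℝ) : IsVolterra (|c| * C) (c • L) := by
  intro K hK B hB z hz t
  have : |(c • L) z t| = |c| * |L z t| := by simp [abs_mul]
  rw [this, mul_div_assoc, mul_assoc]
  exact mul_le_mul_of_nonneg_left (hL K hK B hB z hz t) (abs_nonneg c)

/-- In the weighted norm with `K = 2C + 1` the operator contracts by `1 / 2`, so `‖L ^ n‖ < 1` for
some `n`, however large `L` is. Then `1 - (-L) ^ n` is invertible, and `1 + L` is a factor of it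
commuting with the cofactor. -/
theorem isUnit_one_add (hL : IsVolterra C L) (hC : 0 ≤ C) : IsUnit (1 + L) := by
  set K : ℝ := 2 * C + 1 with hK_def
  have hK : 0 < K := by positivity
  have hCK : C / K ≤ 1 / 2 := by rw [div_le_div_iff₀ hK two_pos]; linarith
  have hpow : ∀ n (z : C(Icc a b, ℝ)) (t : Icc a b),
      |(L ^ n) z t| ≤ (1 / 2) ^ n * ‖z‖ * Real.exp (K * (t - a)) := by
    intro n
    induction n with
    | zero =>
      intro z t
      have h1 : |z t| ≤ ‖z‖ := z.norm_coe_le_norm t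
      have h2 : 1 ≤ Real.exp (K * (t - a)) :=
        Real.one_le_exp (mul_nonneg hK.le (sub_nonneg.2 t.2.1))
      simpa using h1.trans (le_mul_of_one_le_right (norm_nonneg z) h2)
    | succ n ih =>
      intro z t
      have h1 := hL K hK ((1 / 2) ^ n * ‖z‖) (by positivity) ((L ^ n) z) (ih z) t
      have h2 : (L ^ (n + 1)) z t = L ((L ^ n) z) t := by rw [pow_succ']; rfl
      rw [h2]
      refine h1.trans ((mul_le_mul_of_nonneg_right hCK (by positivity)).trans_eq ?_)
      ring
  have hnorm : ∀ n, ‖L ^ n‖ ≤ (1 / 2) ^ n * Real.exp (K * (b - a)) := by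
    intro n
    refine ContinuousLinearMap.opNorm_le_bound _ (by positivity) fun z => ?_
    rw [ContinuousMap.norm_le _ (by positivity)]
    intro t
    refine (hpow n z t).trans ?_
    have : Real.exp (K * (t - a)) ≤ Real.exp (K * (b - a)) := by
      have := t.2.2
      gcongr
    calc (1 / 2) ^ n * ‖z‖ * Real.exp (K * (t - a))
        ≤ (1 / 2) ^ n * ‖z‖ * Real.exp (K * (b - a)) := by gcongr
      _ = _ := by ring
  have hlim : Tendsto (fun n : ℕ => (1 / 2 : ℝ) ^ n * Real.exp (K * (b - a))) atTop (𝓝 0) := by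
    simpa using (tendsto_pow_atTop_nhds_zero_of_lt_one (by norm_num : (0 : ℝ) ≤ 1 / 2)
      (by norm_num)).mul_const (Real.exp (K * (b - a)))
  obtain ⟨n, hn⟩ := (hlim.eventually_lt_const one_pos).exists
  have hn' : ‖(-L) ^ n‖ < 1 := by
    have : ‖(-L) ^ n‖ = ‖L ^ n‖ := by
      rcases n.even_or_odd with h | h
      · exact congrArg _ (h.neg_pow L)
      · exact (congrArg _ (h.neg_pow L)).trans (norm_neg (L ^ n))
    rw [this]
    exact (hnorm n).trans_lt hn
  have hu : IsUnit (1 - (-L) ^ n) :=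
    isUnit_one_sub_of_norm_lt_one (R := C(Icc a b, ℝ) →L[ℝ] C(Icc a b, ℝ)) hn'
  have hcomm : Commute (1 - -L) (∑ i ∈ Finset.range n, (-L) ^ i) :=
    (mul_neg_geom_sum (-L) n).trans (geom_sum_mul_neg (-L) n).symm
  rw [← mul_neg_geom_sum, hcomm.isUnit_mul_iff, sub_neg_eq_add] at hu
  exact hu.1

end IsVolterra

/-! ### The initial value problem. -/

/-- The solution `y` of `y^{ΔΔ} + (q + lam) y^σ = 0`, `y(a) = 0`, `y^Δ(a) = 1`, with `v = y^Δ`. -/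
structure IsShot (T : Set ℝ) (a b : ℝ) (q : ℝ → ℝ) (lam : ℝ) (y v : ℝ → ℝ) : Prop where
  cont : Continuous y
  contDeriv : Continuous v
  eq : ∀ t ∈ Icc a b, y t = primitive T a (fun w => v w.1) t
  derivEq : ∀ t, v t = 1 - primitive T a (fun w => (q w.1 + lam) * y w.2) t

namespace IsCompactScale

theorem exists_volterra (hT : IsCompactScale T a b) {p : ℝ → ℝ} (hp : Continuous p) :
    ∃ (C : ℝ) (L : C(Icc a b, ℝ) →L[ℝ] C(Icc a b, ℝ)), 0 ≤ C ∧ IsVolterra C L ∧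
      ∀ z t, L z t = volterra T a p (IccExtend hT.left_le_right z) t := by
  have hab := hT.left_le_right
  obtain ⟨M, hM⟩ := hT.isCompact.exists_bound_of_continuousOn hp.continuousOn
  have hM0 : 0 ≤ M := (norm_nonneg _).trans (hM a hT.left_mem)
  have hext : ∀ z : C(Icc a b, ℝ), Continuous (IccExtend hab z) := fun z => z.continuous.Icc_extend'
  let L₀ : C(Icc a b, ℝ) →ₗ[ℝ] C(Icc a b, ℝ) :=
    { toFun := fun z => ⟨fun t => volterra T a p (IccExtend hab z) t,
        (hT.continuous_volterra hp (hext z)).comp continuous_subtype_val⟩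
      map_add' := fun y z => by
        ext t
        exact hT.volterra_add_right hp (hext y) (hext z) t
      map_smul' := fun c z => by
        ext t
        exact volterra_const_mul c p (IccExtend hab z) t }
  have hbound : ∀ K > 0, ∀ B ≥ 0, ∀ z : C(Icc a b, ℝ),
      (∀ t, |z t| ≤ B * Real.exp (K * (t - a))) →
      ∀ t, |L₀ z t| ≤ M * (b - a) / K * (B * Real.exp (K * (t - a))) := by
    intro K hK B hB z hz t
    refine hT.abs_volterra_le hM0 hB hK hM (fun x hx => ?_) t.2
    have hx' : x ∈ Icc a b := ⟨hT.left_le hx, hT.le_right hx⟩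
    rw [IccExtend_of_mem hab _ hx']
    exact hz ⟨x, hx'⟩
  have hba : 0 ≤ b - a := sub_nonneg.2 hab
  refine ⟨M * (b - a), L₀.mkContinuous (M * (b - a) * Real.exp (b - a)) fun z => ?_,
    by positivity, hbound, fun z t => rfl⟩
  rw [ContinuousMap.norm_le _ (by positivity)]
  intro t
  -- The weighted bound with `K = 1` already gives boundedness in the sup norm.
  have h1 := hbound 1 one_pos ‖z‖ (norm_nonneg z) z (fun t => by
    have h1 : |z t| ≤ ‖z‖ := z.norm_coe_le_norm t
    exact h1.trans (le_mul_of_one_le_right (norm_nonneg z)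
      (Real.one_le_exp (mul_nonneg one_pos.le (sub_nonneg.2 t.2.1))))) t
  refine h1.trans ?_
  have h2 : Real.exp (1 * (t - a)) ≤ Real.exp (b - a) := by
    have := t.2.2
    rw [one_mul]
    gcongr
  rw [div_one]
  calc M * (b - a) * (‖z‖ * Real.exp (1 * (t - a)))
      ≤ M * (b - a) * (‖z‖ * Real.exp (b - a)) := by gcongr
    _ = _ := by ring

/-- The initial value problem is solvable, with continuous dependence on the parameter. -/
theorem exists_shot (hT : IsCompactScale T a b) {q : ℝ → ℝ} (hq : Continuous q) :
    ∃ y v : ℝ → ℝ → ℝ, (∀ lam, IsShot T a b q lam (y lam) (v lam)) ∧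
      ∀ lam, ∀ ε > 0, ∀ᶠ μ in 𝓝 lam, ∀ x ∈ Icc a b, |y μ x - y lam x| < ε := by
  have hab := hT.left_le_right
  obtain ⟨C, A, hC, hA, hA'⟩ := hT.exists_volterra hq
  obtain ⟨D, B, hD, hB, hB'⟩ := hT.exists_volterra (continuous_const (y := (1 : ℝ)))
  -- Integrating the equation twice gives `(1 + A + lam • B) y = t - a`. Inversion is continuous at
  -- units, so the solution depends on `lam` continuously in the sup norm.
  set G : ℝ → C(Icc a b, ℝ) →L[ℝ] C(Icc a b, ℝ) := fun lam => 1 + (A + lam • B) with hG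
  have hunit : ∀ lam, IsUnit (G lam) := fun lam =>
    (hA.add (hB.smul lam)).isUnit_one_add (by positivity)
  have hGc : Continuous G := by fun_prop
  set e : C(Icc a b, ℝ) := ⟨fun t => t - a, by fun_prop⟩ with he
  set Y : ℝ → C(Icc a b, ℝ) := fun lam => Ring.inverse (G lam) e with hY
  have hYc : Continuous Y := by
    rw [continuous_iff_continuousAt]
    intro lam
    obtain ⟨u, hu⟩ := hunit lam
    have h1 : ContinuousAt Ring.inverse (G lam) := hu ▸
      NormedRing.inverse_continuousAt (R := C(Icc a b, ℝ) →L[ℝ] C(Icc a b, ℝ)) u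
    have h2 : ContinuousAt (fun lam => Ring.inverse (G lam)) lam :=
      ContinuousAt.comp (f := G) h1 hGc.continuousAt
    exact h2.clm_apply continuousAt_const
  have hYeq : ∀ lam, G lam (Y lam) = e := by
    intro lam
    have := Ring.mul_inverse_cancel _ (hunit lam)
    exact congrArg (fun L : C(Icc a b, ℝ) →L[ℝ] C(Icc a b, ℝ) => L e) this
  have hext : ∀ z : C(Icc a b, ℝ), Continuous (IccExtend hab z) := fun z => z.continuous.Icc_extend'
  set y : ℝ → ℝ → ℝ := fun lam => IccExtend hab (Y lam) with hy
  have hint : ∀ lam, ∀ t ∈ Icc a b,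
      y lam t = (t - a) - volterra T a (fun x => q x + lam) (y lam) t := by
    intro lam t ht
    have h1 := congrArg (fun z : C(Icc a b, ℝ) => z ⟨t, ht⟩) (hYeq lam)
    have h2 : Y lam ⟨t, ht⟩ + (A (Y lam) ⟨t, ht⟩ + lam * B (Y lam) ⟨t, ht⟩) = t - a := h1
    rw [hA', hB'] at h2
    rw [hT.volterra_add_left hq continuous_const (hext _), volterra_const_left]
    have h3 : y lam t = Y lam ⟨t, ht⟩ := IccExtend_of_mem hab _ ht
    rw [h3]
    linarith
  have hpc : ∀ lam, Continuous (primitive T a fun w => (q w.1 + lam) * y lam w.2) := fun lam =>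
    hT.continuous_primitive (by have := hext (Y lam); fun_prop)
  refine ⟨y, fun lam t => 1 - primitive T a (fun w => (q w.1 + lam) * y lam w.2) t, fun lam =>
    ⟨hext _, continuous_const.sub (hpc lam), fun t ht => ?_, fun t => rfl⟩, fun lam ε hε => ?_⟩
  · rw [hint lam t ht, volterra]
    have h1 := hT.primitive_add (g := fun _ => 1)
      (h := fun w => -1 * primitive T a (fun w => (q w.1 + lam) * y lam w.2) w.1)
      continuous_const (continuous_const.mul ((hpc lam).comp continuous_fst)) t
    rw [primitive_const_mul] at h1
    have h2 : primitive T a (fun _ => 1) t = t - a := by simp [primitive]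
    rw [h2] at h1
    simp only [neg_mul, one_mul, ← sub_eq_add_neg] at h1
    exact h1.symm
  · have h1 := hYc.continuousAt (x := lam)
    rw [ContinuousAt, Metric.tendsto_nhds] at h1
    filter_upwards [h1 ε hε] with μ hμ x hx
    simp only [hy, IccExtend_of_mem hab _ hx]
    have := (ContinuousMap.dist_lt_iff hε).1 hμ ⟨x, hx⟩
    rwa [Real.dist_eq] at this

end IsCompactScale

theorem hasDeltaDerivAt_const (c : ℝ) : HasDeltaDerivAt T (fun _ => c) 0 t := fun ε hε =>
  ⟨1, one_pos, fun s _ _ => by simpa using mul_nonneg hε.le (abs_nonneg _)⟩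

theorem hasDeltaDerivAt_const_mul_id (c : ℝ) : HasDeltaDerivAt T (fun x => c * x) c t :=
  fun ε hε => ⟨1, one_pos, fun s _ _ => by
    have : c * sigma T t - c * s - c * (sigma T t - s) = 0 := by ring
    rw [this, abs_zero]
    positivity⟩

theorem HasDeltaDerivAt.congr {f g : ℝ → ℝ} {d : ℝ} (hT : IsCompactScale T a b)
    (h : HasDeltaDerivAt T f d t) (hfg : EqOn f g T) : HasDeltaDerivAt T g d t := by
  intro ε hε
  obtain ⟨δ, hδ, H⟩ := h ε hε
  exact ⟨δ, hδ, fun s hs hst => by rw [← hfg hs, ← hfg (hT.sigma_mem t)]; exact H s hs hst⟩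

theorem IsAntiderivative.congr {f g F : ℝ → ℝ} (h : IsAntiderivative T f F)
    (hfg : EqOn f g (kappa T)) : IsAntiderivative T g F := fun t ht => hfg ht ▸ h t ht

namespace IsShot

variable {q y v : ℝ → ℝ} {lam : ℝ}

theorem left (hs : IsShot T a b q lam y v) (hab : a ≤ b) : y a = 0 := by
  rw [hs.eq a ⟨le_rfl, hab⟩, IsCompactScale.primitive_left]

theorem deriv_left (hs : IsShot T a b q lam y v) : v a = 1 := by
  rw [hs.derivEq a, IsCompactScale.primitive_left, sub_zero]

theorem hasDeltaDerivAt (hs : IsShot T a b q lam y v) (hT : IsCompactScale T a b) (ht : t ∈ T) :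
    HasDeltaDerivAt T y (v t) t :=
  (hT.hasDeltaDerivAt_primitive (hs.contDeriv.comp continuous_fst) ht).congr hT fun x hx =>
    (hs.eq x ⟨hT.left_le hx, hT.le_right hx⟩).symm

theorem hasDeltaDerivAt_deriv (hs : IsShot T a b q lam y v) (hT : IsCompactScale T a b)
    (hq : Continuous q) (ht : t ∈ T) :
    HasDeltaDerivAt T v (-((q t + lam) * y (sigma T t))) t := by
  have hc := hs.cont
  have h1 := hT.hasDeltaDerivAt_primitive (h := fun w => (q w.1 + lam) * y w.2) (by fun_prop) ht
  have h2 := (hasDeltaDerivAt_const (T := T) (t := t) 1).sub h1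
  rw [zero_sub] at h2
  exact h2.congr hT fun x _ => (hs.derivEq x).symm

/-! ### Picone's inequality. -/

/-- The Picone inequality: a positive solution makes the quadratic functional nonnegative. -/
theorem picone (hs : IsShot T a b q lam y v) (hT : IsCompactScale T a b) (hab : a < b)
    (hq : Continuous q) (hpos : ∀ t ∈ T, a < t → 0 < y t) {η g F : ℝ → ℝ}
    (hη : ∀ t ∈ kappa T, HasDeltaDerivAt T η (g t) t) (hηa : η a = 0) (hηb : η b = 0)
    (hF : IsAntiderivative T (fun t => g t ^ 2 - (q t + lam) * η (sigma T t) ^ 2) F) :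
    F a ≤ F b := by
  -- On `(a, b)` the delta derivative of `Φ` is `(η^Δ y - η y^Δ)² / (y y^σ) ≥ 0`, and `Φ b = F b`
  -- because `η b = 0`. The left end needs separate care since `y a = 0`.
  set Φ : ℝ → ℝ := fun t => F t - η t ^ 2 * v t / y t with hΦ
  have hΦb : Φ b = F b := by simp [hΦ, hηb]
  have hηc := hT.continuousOn_of_deltaDeriv hη
  have hFc := hT.continuousOn_of_deltaDeriv hF
  have hyc := hs.cont
  have hvc := hs.contDeriv
  have hmain : ∀ t₀ ∈ T, a < t₀ → Φ t₀ ≤ F b := by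
    intro t₀ ht₀ hat₀
    rw [← hΦb]
    have hΦc : ContinuousOn Φ (T ∩ Ioi a) := by
      refine (hFc.mono inter_subset_left).sub ((((hηc.mono inter_subset_left).pow 2).mul
        hvc.continuousOn).div hyc.continuousOn fun x hx => (hpos x hx.1 hx.2).ne')
    refine hT.le_of_forall_exists_gt ht₀ (hT.le_right ht₀) (hΦc.mono fun x hx =>
      ⟨hx.1, mem_Ioi.2 (hat₀.trans_le hx.2.1)⟩) fun x hx h1 hxb ε hε => ?_
    have hxa : a < x := hat₀.trans_le h1
    have hxk := hT.mem_kappa_of_lt hx hxb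
    have hYpos := hpos x hx hxa
    suffices ∃ d, 0 ≤ d ∧ HasDeltaDerivAt T Φ d x by
      obtain ⟨d, hd, h⟩ := this
      exact hT.exists_gt_of_deltaDeriv_nonneg hx hT.right_mem hxb hd h hε
    have dη := hη x hxk
    have dF : HasDeltaDerivAt T F (g x ^ 2 - (q x + lam) * η (sigma T x) ^ 2) x := hF x hxk
    have dy := hs.hasDeltaDerivAt hT hx
    have dv := hs.hasDeltaDerivAt_deriv hT hq hx
    rcases (hT.le_sigma hx).lt_or_eq with hσ | hσ
    · have hYσ := hpos _ (hT.sigma_mem x) (hxa.trans hσ)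
      rw [IsCompactScale.hasDeltaDerivAt_iff_of_lt hx hσ] at dη dF dy dv
      have hΦx : ContinuousWithinAt Φ T x :=
        dF.1.sub (((dη.1.pow 2).mul dv.1).div dy.1 hYpos.ne')
      refine ⟨(Φ (sigma T x) - Φ x) / (sigma T x - x), ?_, ?_⟩
      · set m := sigma T x
        set μ := m - x with hμ
        have hμ0 : 0 < μ := sub_pos.2 hσ
        refine div_nonneg ?_ hμ0.le
        have e1 : y m = y x + v x * μ := by linarith [dy.2]
        have e2 : η m = η x + g x * μ := by linarith [dη.2]
        have e3 : v m = v x - (q x + lam) * y m * μ := by linarith [dv.2]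
        have e4 : F m = F x + (g x ^ 2 - (q x + lam) * η m ^ 2) * μ := by linarith [dF.2]
        have key : Φ m - Φ x = μ * (g x * y x - η x * v x) ^ 2 / (y x * y m) := by
          simp only [hΦ]
          rw [e4, e3]
          field_simp
          rw [e2, e1]
          ring
        rw [key]
        positivity
      · rw [IsCompactScale.hasDeltaDerivAt_iff_of_lt hx hσ]
        refine ⟨hΦx, ?_⟩
        rw [div_mul_cancel₀ _ (sub_pos.2 hσ).ne']
    · rw [IsCompactScale.hasDeltaDerivAt_iff_of_eq hσ.symm] at dη dF dy dv
      rw [← hσ] at dv dF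
      refine ⟨(g x - η x * v x / y x) ^ 2, sq_nonneg _, ?_⟩
      rw [IsCompactScale.hasDeltaDerivAt_iff_of_eq hσ.symm]
      have := dF.sub (((dη.pow 2).mul dv).div dy hYpos.ne')
      refine this.congr_deriv ?_
      have := hYpos.ne'
      simp only [Pi.pow_apply, Pi.mul_apply]
      field_simp
      ring
  have hak := hT.mem_kappa_of_lt hT.left_mem hab
  have dη := hη a hak
  have dF := hF a hak
  have dy := hs.hasDeltaDerivAt hT hT.left_mem
  have dv := hs.hasDeltaDerivAt_deriv hT hq hT.left_mem
  have hya := hs.left hab.le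
  have hva := hs.deriv_left
  -- If `a` is followed by a gap, `Φ (σ a) = F a` by direct computation. Otherwise `η² / y` is `(x -
  -- a)` times the squared slope of `η` over the slope of `y`, and the latter tends to `1`, so `Φ →
  -- F a`.
  rcases (hT.le_sigma hT.left_mem).lt_or_eq with hσ | hσ
  · rw [IsCompactScale.hasDeltaDerivAt_iff_of_lt hT.left_mem hσ] at dη dF dy dv
    refine le_trans (le_of_eq ?_) (hmain _ (hT.sigma_mem a) hσ)
    have hYσ := hpos _ (hT.sigma_mem a) hσ
    set m := sigma T a
    have e1 : y m = m - a := by linarith [dy.2, hva ▸ dy.2]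
    have e2 : η m = g a * (m - a) := by linarith [dη.2]
    have e3 : v m = 1 - (q a + lam) * y m * (m - a) := by linarith [dv.2]
    have e4 : F m = F a + (g a ^ 2 - (q a + lam) * η m ^ 2) * (m - a) := by linarith [dF.2]
    have : m - a ≠ 0 := (sub_pos.2 hσ).ne'
    simp only [hΦ]
    rw [e4, e3, e2, e1]
    field_simp
    ring
  · have hacc := accPt_principal_iff_nhdsWithin.1 (hT.accPt_of_sigma_eq hab hak hσ.symm)
    rw [IsCompactScale.hasDeltaDerivAt_iff_of_eq hσ.symm] at dη dy dF
    have hFt : Tendsto F (𝓝[T \ {a}] a) (𝓝 (F a)) :=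
      dF.continuousWithinAt.mono_left (nhdsWithin_mono _ sdiff_subset)
    rw [hasDerivWithinAt_iff_tendsto_slope] at dη dy
    rw [hva] at dy
    have hvt : Tendsto v (𝓝[T \ {a}] a) (𝓝 1) := hva ▸ (hvc.tendsto a).mono_left nhdsWithin_le_nhds
    have hid : Tendsto (fun x => x - a) (𝓝[T \ {a}] a) (𝓝 0) := by
      have : Tendsto (fun x => x - a) (𝓝 a) (𝓝 (a - a)) := by
        exact (continuous_id.sub continuous_const).tendsto a
      rw [sub_self] at this
      exact this.mono_left nhdsWithin_le_nhds
    have hlim : Tendsto Φ (𝓝[T \ {a}] a) (𝓝 (F a)) := by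
      have h1 := hFt.sub ((((dη.pow 2).mul hid).mul hvt).div dy one_ne_zero)
      simp only [mul_zero, zero_mul, zero_div, sub_zero] at h1
      refine h1.congr' ?_
      filter_upwards [self_mem_nhdsWithin] with x hx
      have hxa : x - a ≠ 0 := sub_ne_zero.2 hx.2
      have hyx := (hpos x hx.1 (lt_of_le_of_ne (hT.left_le hx.1) (Ne.symm hx.2))).ne'
      simp only [hΦ, slope_def_field, hya, hηa, sub_zero, Pi.div_apply]
      congr 1
      field_simp
    refine le_of_tendsto hlim ?_
    filter_upwards [self_mem_nhdsWithin] with x hx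
    exact hmain x hx.1 (lt_of_le_of_ne (hT.left_le hx.1) (Ne.symm hx.2))

end IsShot

/-! ### The quadratic functionals and a test function. -/

namespace IsCompactScale

theorem exists_antiderivative (hT : IsCompactScale T a b) {q η g : ℝ → ℝ} (hq : ContinuousOn q T)
    (hη : ContinuousOn η T) (hg : ContinuousOn g (kappa T)) :
    ∃ F, IsAntiderivative T (fun t => g t ^ 2 - q t * η (sigma T t) ^ 2) F := by
  obtain ⟨q', hq', eq⟩ := hT.exists_continuous_eqOn hq
  obtain ⟨η', hη', eη⟩ := hT.exists_continuous_eqOn hη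
  obtain ⟨g', hg', eg⟩ := hT.kappa_scale.exists_continuous_eqOn hg
  refine ⟨_, (hT.isAntiderivative_primitive
    (h := fun w => g' w.1 ^ 2 - q' w.1 * η' w.2 ^ 2) (by fun_prop)).congr fun t ht => ?_⟩
  simp only [← eg ht, ← eq (hT.kappa_subset ht), ← eη (hT.sigma_mem t)]

theorem exists_antiderivative_sq (hT : IsCompactScale T a b) {η : ℝ → ℝ}
    (hη : ContinuousOn η T) : ∃ F, IsAntiderivative T (fun t => η (sigma T t) ^ 2) F := by
  obtain ⟨F, hF⟩ := hT.exists_antiderivative (q := fun _ => -1) (g := fun _ => 0)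
    continuousOn_const hη continuousOn_const
  exact ⟨F, hF.congr fun t _ => by simp⟩

/-- `F` is nondecreasing with `F b ≤ F a`, hence constant, so `η ∘ σ` vanishes on `T^κ`. Every
left-scattered point is a forward jump, and a left-dense point is reached as a limit from the left.
-/
theorem eq_zero_of_antiderivative_sq (hT : IsCompactScale T a b) (hab : a < b) {η F : ℝ → ℝ}
    (hη : ContinuousOn η T) (hηa : η a = 0) (hF : IsAntiderivative T (fun t => η (sigma T t) ^ 2) F)
    (h : F b ≤ F a) : ∀ t ∈ T, η t = 0 := by
  have hmono : ∀ u ∈ T, ∀ w ∈ T, u ≤ w → F u ≤ F w := fun u hu w hw huw =>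
    hT.le_of_deltaDeriv_nonneg hF (fun _ _ => sq_nonneg _) hu hw huw
  have hconst : EqOn (fun _ => F a) F T := fun t ht => le_antisymm
    (hmono a hT.left_mem t ht (hT.left_le ht))
    ((hmono t ht b hT.right_mem (hT.le_right ht)).trans h)
  have hσ : ∀ t ∈ kappa T, η (sigma T t) = 0 := fun t ht =>
    pow_eq_zero_iff two_ne_zero |>.1 (hT.hasDeltaDerivAt_unique hab ht (hF t ht)
      ((hasDeltaDerivAt_const (F a)).congr hT hconst))
  intro t ht
  rcases (hT.left_le ht).eq_or_lt with rfl | hat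
  · exact hηa
  rcases (hT.rho_le hat.le).lt_or_eq with h1 | h1
  · rw [← hT.sigma_rho ht h1]
    exact hσ _ (hT.mem_kappa_of_lt (hT.rho_mem hat.le) (h1.trans_le (hT.le_right ht)))
  · have hne : (𝓝[T ∩ Iio t] t).NeBot := by
      rw [← mem_closure_iff_nhdsWithin_neBot, Metric.mem_closure_iff]
      intro ε hε
      obtain ⟨x, hx, h2, h3⟩ := hT.exists_lt_of_rho_eq h1 hat (show t - ε < t by linarith)
      exact ⟨x, ⟨hx, h3⟩, by rw [Real.dist_eq, abs_of_pos] <;> linarith⟩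
    have h2 : Tendsto (fun x => η (sigma T x)) (𝓝[T ∩ Iio t] t) (𝓝 (η t)) :=
      (hη t ht).tendsto.comp (tendsto_nhdsWithin_iff.2
        ⟨hT.tendsto_sigma_left ht, Eventually.of_forall fun x => hT.sigma_mem x⟩)
    refine tendsto_nhds_unique h2 (tendsto_const_nhds.congr' ?_)
    filter_upwards [self_mem_nhdsWithin] with x hx
    exact (hσ x (hT.mem_kappa_of_lt hx.1 (lt_of_lt_of_le hx.2 (hT.le_right ht)))).symm

/-- A nonzero function vanishing at both ends with a continuous delta derivative. -/
theorem exists_test_function (hT : IsCompactScale T a b) (hm : (T ∩ Ioo a b).Nonempty) :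
    ∃ η g : ℝ → ℝ, Continuous g ∧ (∀ t ∈ kappa T, HasDeltaDerivAt T η (g t) t) ∧ η a = 0 ∧
      η b = 0 ∧ ∃ t ∈ T, η t ≠ 0 := by
  obtain ⟨m, hmT, ham, hmb⟩ := hm
  have hab := ham.trans hmb
  -- `α` is the mean of `t` over `[a, b]`, which makes `η b = 0`. As `η^Δ = α - t` cannot vanish at
  -- both `a` and `m`, `η` is not zero.
  set α := primitive T a (fun w => w.1) b / (b - a)
  set η := fun t => α * t - α * a - primitive T a (fun w => w.1) t with hη
  have hd : ∀ t ∈ kappa T, HasDeltaDerivAt T η (α - t) t := fun t ht =>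
    ((sub_zero α) ▸ (hasDeltaDerivAt_const_mul_id α).sub (hasDeltaDerivAt_const (α * a))).sub
      (hT.hasDeltaDerivAt_primitive continuous_fst (hT.kappa_subset ht))
  refine ⟨η, fun t => α - t, by fun_prop, hd, by simp [hη, primitive_left], ?_, ?_⟩
  · simp only [hη, α]
    rw [← mul_sub, div_mul_cancel₀ _ (sub_pos.2 hab).ne', sub_self]
  · by_contra! h0
    have h1 : ∀ t ∈ kappa T, α - t = 0 := fun t ht => hT.hasDeltaDerivAt_unique hab ht (hd t ht)
      ((hasDeltaDerivAt_const 0).congr hT fun x hx => (h0 x hx).symm)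
    have h2 := h1 a (hT.mem_kappa_of_lt hT.left_mem hab)
    have h3 := h1 m (hT.mem_kappa_of_lt hmT hmb)
    linarith

end IsCompactScale

/-! ### Positivity and zeros of the solution of the initial value problem. -/

theorem integral_const_mul_exp_neg (c : ℝ) {K : ℝ} (hK : K ≠ 0) (u w : ℝ) :
    ∫ x in u..w, c * Real.exp (-(K * x))
      = c * Real.exp (-(K * u)) / K - c * Real.exp (-(K * w)) / K := by
  rw [intervalIntegral.integral_eq_sub_of_hasDerivAt (f := fun s => c * Real.exp (-(K * s)) / -K)]
  · rw [div_neg, div_neg]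
    ring
  · intro x _
    have h1 : HasDerivAt (fun s => -(K * s)) (-K) x := by
      simpa using (hasDerivAt_id x).const_mul (-K)
    have := (h1.exp.const_mul c).div_const (-K)
    rwa [← mul_assoc, mul_div_cancel_right₀ _ (neg_ne_zero.2 hK)] at this
  · exact Continuous.intervalIntegrable (by fun_prop) _ _

namespace IsShot

variable {q y v : ℝ → ℝ} {lam : ℝ}

/-- Near the left end the solution grows at least linearly. -/
theorem half_le (hs : IsShot T a b q lam y v) (hT : IsCompactScale T a b) {M B : ℝ} (hM0 : 0 ≤ M)
    (hM : ∀ x ∈ T, |q x + lam| ≤ M) (hB : ∀ x ∈ T, |y x| ≤ B) (ht : t ∈ T)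
    (hsmall : M * B * (t - a) ≤ 1 / 2) : (t - a) / 2 ≤ y t := by
  have hB0 : 0 ≤ B := (abs_nonneg _).trans (hB a hT.left_mem)
  have h := hT.abs_primitive_sub_le (h := fun w => v w.1) (hs.contDeriv.comp continuous_fst)
    (l := 1) (ε := 1 / 2) hT.left_mem (hT.left_le ht) fun x hx _ hxt => by
      rw [hs.derivEq x, sub_sub_cancel_left, abs_neg]
      refine (hT.abs_primitive_le hM0 hM hx fun z hz _ => hB z hz).trans (le_trans ?_ hsmall)
      gcongr
  rw [IsCompactScale.primitive_left, ← hs.eq t ⟨hT.left_le ht, hT.le_right ht⟩] at h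
  linarith [(abs_le.1 h).1]

/-- While `y ≥ 0`, the derivative of `v` is nonnegative, so `v ≥ 1`; up to a first point `m` with `y
m ≤ 0` this gives `y m ≥ m - a > 0`. The linear bound `half_le` on `[a, a + δ]` keeps the zero at
`a` apart, so that such a first point exists. -/
theorem pos_of_nonpos (hs : IsShot T a b q lam y v) (hT : IsCompactScale T a b)
    (hq : Continuous q) (hneg : ∀ t ∈ T, q t + lam ≤ 0) : ∀ t ∈ T, a < t → 0 < y t := by
  have hqc : Continuous fun x => q x + lam := by fun_prop
  obtain ⟨M, hM⟩ := hT.isCompact.exists_bound_of_continuousOn hqc.continuousOn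
  obtain ⟨B, hB⟩ := hT.isCompact.exists_bound_of_continuousOn hs.cont.continuousOn
  have hM0 : 0 ≤ M := (norm_nonneg _).trans (hM a hT.left_mem)
  have hB0 : 0 ≤ B := (norm_nonneg _).trans (hB a hT.left_mem)
  set δ : ℝ := 1 / (2 * (M * B + 1)) with hδ_def
  have hδ : 0 < δ := by positivity
  have hnear : ∀ t ∈ T, t ≤ a + δ → (t - a) / 2 ≤ y t := fun t ht htδ => by
    refine hs.half_le hT hM0 hM hB ht ?_
    have h1 : t - a ≤ δ := by linarith
    calc M * B * (t - a) ≤ (M * B + 1) * δ := by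
          have := hT.left_le ht
          have : 0 ≤ t - a := by linarith
          gcongr
          linarith
      _ = 1 / 2 := by rw [hδ_def]; field_simp
  by_contra! ⟨t₁, ht₁, hat₁, hyt₁⟩
  set Z : Set ℝ := (T ∩ Ici (a + δ)) ∩ y ⁻¹' Iic 0 with hZ
  have hZc : IsCompact Z := (hT.isCompact.inter_right isClosed_Ici).inter_right
    (isClosed_Iic.preimage hs.cont)
  have hZne : Z.Nonempty := by
    refine ⟨t₁, ⟨ht₁, ?_⟩, hyt₁⟩
    by_contra h
    rw [mem_Ici, not_le] at h
    linarith [hnear t₁ ht₁ h.le]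
  obtain ⟨⟨⟨hmT, hmδ⟩, hmy⟩, hmin⟩ := hZc.isLeast_sInf hZne
  set m := sInf Z
  rw [mem_Ici] at hmδ
  replace hmy : y m ≤ 0 := hmy
  have hnn : ∀ x ∈ T, x < m → 0 ≤ y x := by
    intro x hx hxm
    rcases le_total x (a + δ) with h | h
    · linarith [hnear x hx h, hT.left_le hx]
    · by_contra! h2
      exact absurd (hmin ⟨⟨hx, h⟩, h2.le⟩) (by linarith)
  have hv : ∀ x ∈ T, x < m → 1 ≤ v x := by
    intro x hx hxm
    rw [← hs.deriv_left]
    refine hT.le_of_forall_exists_gt hT.left_mem (hT.left_le hx) hs.contDeriv.continuousOn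
      fun z hz _ hzx ε hε => hT.exists_gt_of_deltaDeriv_nonneg hz hx hzx ?_
        (hs.hasDeltaDerivAt_deriv hT hq hz) hε
    have h1 := hnn _ (hT.sigma_mem z) ((hT.sigma_le hx hzx).trans_lt hxm)
    nlinarith [hneg z hz]
  have hfin : y a - 1 * a ≤ y m - 1 * m := by
    refine hT.le_of_forall_exists_gt (f := fun x => y x - 1 * x) hT.left_mem (hT.left_le hmT)
      (hs.cont.sub (continuous_const.mul continuous_id)).continuousOn
      fun z hz _ hzm ε hε => hT.exists_gt_of_deltaDeriv_nonneg hz hmT hzm ?_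
        ((hs.hasDeltaDerivAt hT hz).sub (hasDeltaDerivAt_const_mul_id 1)) hε
    linarith [hv z hz hzm]
  rw [hs.left hT.left_le_right] at hfin
  linarith

/-- A solution with a double zero vanishes to the left of it. -/
theorem eq_zero_of_double_zero (hs : IsShot T a b q lam y v) (hT : IsCompactScale T a b)
    (hq : Continuous q) {t₀ : ℝ} (ht₀ : t₀ ∈ T) (hy0 : y t₀ = 0) (hv0 : v t₀ = 0) :
    ∀ x ∈ T, x ≤ t₀ → y x = 0 := by
  have hyc := hs.cont
  have hvc := hs.contDeriv
  have hqc : Continuous fun x => q x + lam := by fun_prop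
  obtain ⟨M, hM⟩ := hT.isCompact.exists_bound_of_continuousOn hqc.continuousOn
  have hM0 : 0 ≤ M := (norm_nonneg _).trans (hM a hT.left_mem)
  have hba : 0 ≤ b - a := sub_nonneg.2 hT.left_le_right
  -- A backward Gronwall argument: with `B` the maximum of `|y| exp (K x)` to the left of `t₀`,
  -- integrating twice back from `t₀` gives `B ≤ M (b - a) B / K`, and this `K` forces `B = 0`.
  set K : ℝ := 2 * (M * (b - a)) + 1 with hK_def
  have hK : 0 < K := by positivity
  have hAc : IsCompact (T ∩ Iic t₀) := hT.isCompact.inter_right isClosed_Iic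
  have hwc : Continuous fun x => |y x| * Real.exp (K * x) := by fun_prop
  obtain ⟨z, ⟨hzT, hzt⟩, hmax⟩ := hAc.exists_isMaxOn ⟨t₀, ht₀, mem_Iic.2 le_rfl⟩ hwc.continuousOn
  rw [mem_Iic] at hzt
  set B := |y z| * Real.exp (K * z) with hB_def
  have hB0 : 0 ≤ B := by positivity
  have hB : ∀ x ∈ T, x ≤ t₀ → |y x| ≤ B * Real.exp (-(K * x)) := by
    intro x hx hxt
    have h1 : |y x| * Real.exp (K * x) ≤ B := hmax ⟨hx, hxt⟩
    rw [Real.exp_neg, ← div_eq_mul_inv, le_div_iff₀ (Real.exp_pos _)]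
    exact h1
  have hne : ∀ᵐ s : ℝ, s ≠ t₀ := by simp [ae_iff]
  have hv : ∀ x, x ∈ Ico z t₀ → |v (floor T a x)| ≤ M * (b - a) * B * Real.exp (-(K * x)) := by
    intro x hx
    have hax : a ≤ x := (hT.left_le hzT).trans hx.1
    have hxb : x ≤ b := hx.2.le.trans (hT.le_right ht₀)
    set w := floor T a x with hw
    have hwT : w ∈ T := hT.floor_mem x
    have hwt : w ≤ t₀ := (hT.floor_le hax).trans hx.2.le
    have h1 : v w = ∫ τ in w..t₀, (q (floor T a τ) + lam) * y (ceil T a τ) := by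
      have := hT.primitive_sub (h := fun w => (q w.1 + lam) * y w.2) (by fun_prop) w t₀
      rw [← this]
      have e1 := hs.derivEq w
      have e2 := hs.derivEq t₀
      linarith
    have h2 : |v w| ≤ M * (B * Real.exp (-(K * x))) * |t₀ - w| := by
      rw [h1, ← Real.norm_eq_abs]
      refine intervalIntegral.norm_integral_le_of_norm_le_const_ae ?_
      filter_upwards [hne] with τ hτ hτ2
      rw [uIoc_of_le hwt] at hτ2
      have haτ : a ≤ τ := (hT.left_le hwT).trans hτ2.1.le
      have hct : ceil T a τ ≤ t₀ := hT.ceil_le ht₀ haτ (lt_of_le_of_ne hτ2.2 hτ)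
      -- `τ` may start before `x`, at the floor of `x`, but `y` is evaluated at the ceiling, which
      -- lies at or after `x`; so the weight at `x` bounds it.
      have hxc : x ≤ ceil T a τ := (hT.le_ceil hxb).trans
        (hT.sigma_mono (hT.le_floor hwT hτ2.1.le))
      rw [norm_mul]
      refine mul_le_mul (hM _ (hT.floor_mem τ)) ((hB _ (hT.ceil_mem τ) hct).trans ?_)
        (norm_nonneg _) hM0
      gcongr
    refine h2.trans ?_
    rw [abs_of_nonneg (sub_nonneg.2 hwt)]
    have h3 : t₀ - w ≤ b - a := by linarith [hT.left_le hwT, hT.le_right ht₀]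
    calc M * (B * Real.exp (-(K * x))) * (t₀ - w)
        ≤ M * (B * Real.exp (-(K * x))) * (b - a) := by gcongr
      _ = _ := by ring
  have hyz : |y z| ≤ ∫ x in z..t₀, M * (b - a) * B * Real.exp (-(K * x)) := by
    have h1 : -y z = ∫ x in z..t₀, v (floor T a x) := by
      have := hT.primitive_sub (h := fun w => v w.1) (by fun_prop) z t₀
      rw [← this, ← hs.eq z ⟨hT.left_le hzT, hT.le_right hzT⟩,
        ← hs.eq t₀ ⟨hT.left_le ht₀, hT.le_right ht₀⟩, hy0, zero_sub]
    rw [← abs_neg, h1, ← Real.norm_eq_abs]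
    refine intervalIntegral.norm_integral_le_of_norm_le hzt ?_
      (Continuous.intervalIntegrable (by fun_prop) _ _)
    filter_upwards [hne] with x hx hx2
    exact hv x ⟨hx2.1.le, lt_of_le_of_ne hx2.2 hx⟩
  have hint : ∫ x in z..t₀, M * (b - a) * B * Real.exp (-(K * x))
      = M * (b - a) * B * Real.exp (-(K * z)) / K - M * (b - a) * B * Real.exp (-(K * t₀)) / K :=
    integral_const_mul_exp_neg _ hK.ne' _ _
  rw [hint] at hyz
  have h4 : 0 ≤ M * (b - a) * B * Real.exp (-(K * t₀)) / K := by positivity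
  have h5 : B ≤ M * (b - a) * B / K := by
    calc B ≤ M * (b - a) * B * Real.exp (-(K * z)) / K * Real.exp (K * z) := by
          rw [hB_def]; gcongr; exact hyz.trans (by linarith)
      _ = M * (b - a) * B / K * (Real.exp (-(K * z)) * Real.exp (K * z)) := by ring
      _ = _ := by rw [← Real.exp_add, neg_add_cancel, Real.exp_zero, mul_one]
  have h6 : B ≤ 0 := by
    rw [le_div_iff₀ hK, hK_def] at h5
    nlinarith [mul_nonneg (mul_nonneg hM0 hba) hB0]
  intro x hx hxt
  have := (hB x hx hxt).trans (mul_nonpos_of_nonpos_of_nonneg h6 (Real.exp_pos _).le)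
  exact abs_eq_zero.1 (le_antisymm this (abs_nonneg _))

/-- A nonnegative solution has no interior zeros. -/
theorem pos_of_nonneg (hs : IsShot T a b q lam y v) (hT : IsCompactScale T a b)
    (hq : Continuous q) (hnn : ∀ x ∈ T, 0 ≤ y x) {t₀ : ℝ} (ht₀ : t₀ ∈ T) (hat : a < t₀)
    (htb : t₀ < b) : 0 < y t₀ := by
  refine lt_of_le_of_ne (hnn t₀ ht₀) fun hy0 => ?_
  have hy0 : y t₀ = 0 := hy0.symm
  have hvc := hs.contDeriv
  -- At a zero of `y`, `v t₀ < 0` would make `y` negative somewhere to the right and `v t₀ > 0`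
  -- somewhere to the left. Across a left gap the equation gives `v (ρ t₀) = v t₀`, as its
  -- zeroth-order term contains `y (σ (ρ t₀)) = y t₀ = 0`.
  have hv_nonneg : 0 ≤ v t₀ := by
    by_contra! hlt
    have hd := (hasDeltaDerivAt_const_mul_id (T := T) (t := t₀) (v t₀)).sub
      (hs.hasDeltaDerivAt hT ht₀)
    obtain ⟨x, hx, h1, -, h2⟩ := hT.exists_gt_of_deltaDeriv_nonneg ht₀ hT.right_mem htb
      (sub_self _).ge hd (ε := -v t₀ / 2) (by linarith)
    nlinarith [hnn x hx]
  have hv_nonpos : v t₀ ≤ 0 := by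
    by_contra! hlt
    rcases (hT.rho_le hat.le).lt_or_eq with h1 | h1
    · have hr := hT.rho_mem hat.le
      have hσ := hT.sigma_rho ht₀ h1
      have e1 := ((IsCompactScale.hasDeltaDerivAt_iff_of_lt hr (by rwa [hσ])).1
        (hs.hasDeltaDerivAt hT hr)).2
      have e2 := ((IsCompactScale.hasDeltaDerivAt_iff_of_lt hr (by rwa [hσ])).1
        (hs.hasDeltaDerivAt_deriv hT hq hr)).2
      rw [hσ, hy0] at e1 e2
      have e3 : v t₀ = v (rho T t₀) := by linarith
      rw [← e3] at e1
      nlinarith [hnn _ hr]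
    · obtain ⟨δ, hδ, H⟩ := Metric.continuousAt_iff.1 (hvc.continuousAt (x := t₀)) (v t₀ / 2)
        (by linarith)
      obtain ⟨s, hsT, h2, h3⟩ := hT.exists_lt_of_rho_eq h1 hat (show t₀ - δ < t₀ by linarith)
      have h4 := hT.abs_primitive_sub_le (h := fun w => v w.1) (by fun_prop) (l := v t₀)
        (ε := v t₀ / 2) hsT h3.le fun x hx h5 h6 =>
          (H (x := x) (by rw [Real.dist_eq, abs_lt]; constructor <;> linarith)).le
      rw [← hs.eq s ⟨hT.left_le hsT, hT.le_right hsT⟩, ← hs.eq t₀ ⟨hat.le, htb.le⟩, hy0] at h4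
      nlinarith [(abs_le.1 h4).1, hnn s hsT]
  have hv0 : v t₀ = 0 := le_antisymm hv_nonpos hv_nonneg
  -- The double zero makes `y` vanish on `[a, t₀]`; then the integral formula for `v` yields `v t₀ =
  -- 1`, a contradiction.
  have hz := hs.eq_zero_of_double_zero hT hq ht₀ hy0 hv0
  have hqc : Continuous fun x => q x + lam := by fun_prop
  obtain ⟨M, hM⟩ := hT.isCompact.exists_bound_of_continuousOn hqc.continuousOn
  have h1 := hT.abs_primitive_le (p := fun x => q x + lam) (y := y) (B := 0)
    ((norm_nonneg _).trans (hM a hT.left_mem)) hM ht₀ fun x hx hxt => by rw [hz x hx hxt, abs_zero]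
  rw [mul_zero, zero_mul] at h1
  have h2 := hs.derivEq t₀
  rw [abs_eq_zero.1 (le_antisymm h1 (abs_nonneg _)), hv0] at h2
  norm_num at h2

theorem ne_zero (hs : IsShot T a b q lam y v) (hT : IsCompactScale T a b) (hab : a < b) :
    ∃ t ∈ T, y t ≠ 0 := by
  by_contra! h0
  have h1 := hT.hasDeltaDerivAt_unique hab (hT.mem_kappa_of_lt hT.left_mem hab)
    (hs.hasDeltaDerivAt hT hT.left_mem)
    ((hasDeltaDerivAt_const 0).congr hT fun x hx => (h0 x hx).symm)
  rw [hs.deriv_left] at h1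
  exact one_ne_zero h1

end IsShot

/-! ### The first eigenvalue as a supremum. -/

namespace IsCompactScale

/-- Positivity of the solution of the initial value problem is an open condition on `lam`. -/
theorem eventually_pos (hT : IsCompactScale T a b) {q : ℝ → ℝ} (hq : Continuous q)
    {y v : ℝ → ℝ → ℝ} (hs : ∀ lam, IsShot T a b q lam (y lam) (v lam))
    (hc : ∀ lam, ∀ ε > 0, ∀ᶠ μ in 𝓝 lam, ∀ x ∈ Icc a b, |y μ x - y lam x| < ε) {lam : ℝ}
    (hpos : ∀ t ∈ T, a < t → 0 < y lam t) :
    ∀ᶠ μ in 𝓝 lam, ∀ t ∈ T, a < t → 0 < y μ t := by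
  obtain ⟨M, hM⟩ := hT.isCompact.exists_bound_of_continuousOn hq.continuousOn
  obtain ⟨B, hB⟩ := hT.isCompact.exists_bound_of_continuousOn (hs lam).cont.continuousOn
  have hM0 : 0 ≤ M := (norm_nonneg _).trans (hM a hT.left_mem)
  have hB0 : 0 ≤ B := (norm_nonneg _).trans (hB a hT.left_mem)
  -- Uniform closeness says nothing near the zero at `a`. There `half_le` applies to all `μ` near
  -- `lam` with the common bounds `M'` for `|q + μ|` and `B + 1` for `|y μ|`; beyond `a + δ`, `y
  -- lam` has a positive lower bound `m`.
  set M' := M + (|lam| + 1) with hM'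
  have hM'0 : 0 ≤ M' := by positivity
  set δ : ℝ := 1 / (2 * (M' * (B + 1) + 1)) with hδ_def
  have hδ : 0 < δ := by positivity
  obtain ⟨m, hm, hmin⟩ := (hT.isCompact.inter_right (isClosed_Ici (a := a + δ))).exists_forall_le'
    (hs lam).cont.continuousOn (a := 0) fun x hx => hpos x hx.1 (by linarith [mem_Ici.1 hx.2])
  filter_upwards [hc lam (min 1 m) (lt_min one_pos hm), Metric.ball_mem_nhds lam one_pos]
    with μ hμ hμ2 t ht hat
  rw [Metric.mem_ball, Real.dist_eq] at hμ2
  have hμ1 : ∀ x ∈ T, |y μ x - y lam x| < min 1 m := fun x hx =>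
    hμ x ⟨hT.left_le hx, hT.le_right hx⟩
  rcases le_total t (a + δ) with h | h
  · have h1 : (t - a) / 2 ≤ y μ t := by
      refine (hs μ).half_le hT (M := M') (B := B + 1) hM'0 (fun x hx => ?_) (fun x hx => ?_) ht ?_
      · have h2 : |q x| ≤ M := hM x hx
        have h3 : |μ| ≤ |lam| + 1 := by
          have := abs_add_le (μ - lam) lam
          rw [sub_add_cancel] at this
          linarith
        exact (abs_add_le _ _).trans (by linarith)
      · have h2 : |y lam x| ≤ B := hB x hx
        have h3 := abs_add_le (y μ x - y lam x) (y lam x)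
        rw [sub_add_cancel] at h3
        linarith [(hμ1 x hx).trans_le (min_le_left _ _)]
      · have h1 : t - a ≤ δ := by linarith
        have h2 : 0 ≤ t - a := by linarith
        calc M' * (B + 1) * (t - a) ≤ (M' * (B + 1) + 1) * δ := by gcongr; linarith
          _ = 1 / 2 := by rw [hδ_def]; field_simp
    linarith
  · have h1 := hmin t ⟨ht, mem_Ici.2 h⟩
    have h2 := (abs_lt.1 ((hμ1 t ht).trans_le (min_le_right _ _))).1
    linarith

theorem antiderivative_shift {q η g F G : ℝ → ℝ} (lam : ℝ)
    (hF : IsAntiderivative T (fun t => g t ^ 2 - q t * η (sigma T t) ^ 2) F)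
    (hG : IsAntiderivative T (fun t => η (sigma T t) ^ 2) G) :
    IsAntiderivative T (fun t => g t ^ 2 - (q t + lam) * η (sigma T t) ^ 2)
      (fun t => F t - lam * G t) := by
  intro t ht
  have := (hF t ht).sub ((hG t ht).const_mul lam)
  convert this using 1
  ring

/-- A parameter for which the solution of the initial value problem vanishes at `b`, and which is
a lower bound of the Rayleigh quotient. -/
theorem exists_first_eigenvalue (hT : IsCompactScale T a b) (hm : (T ∩ Ioo a b).Nonempty)
    {q : ℝ → ℝ} (hq : Continuous q) :
    ∃ (lam : ℝ) (y v : ℝ → ℝ), IsShot T a b q lam y v ∧ y b = 0 ∧ ∀ η g F G : ℝ → ℝ,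
      (∀ t ∈ kappa T, HasDeltaDerivAt T η (g t) t) → η a = 0 → η b = 0 →
      IsAntiderivative T (fun t => g t ^ 2 - q t * η (sigma T t) ^ 2) F →
      IsAntiderivative T (fun t => η (sigma T t) ^ 2) G →
      lam * (G b - G a) ≤ F b - F a := by
  have hab : a < b := by obtain ⟨m, -, h1, h2⟩ := hm; exact h1.trans h2
  obtain ⟨y, v, hs, hc⟩ := hT.exists_shot hq
  set S : Set ℝ := {lam | ∀ t ∈ T, a < t → 0 < y lam t} with hS
  have hray : ∀ lam ∈ S, ∀ η g F G : ℝ → ℝ,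
      (∀ t ∈ kappa T, HasDeltaDerivAt T η (g t) t) → η a = 0 → η b = 0 →
      IsAntiderivative T (fun t => g t ^ 2 - q t * η (sigma T t) ^ 2) F →
      IsAntiderivative T (fun t => η (sigma T t) ^ 2) G →
      lam * (G b - G a) ≤ F b - F a := by
    intro lam hlam η g F G hη ha hb hF hG
    have := (hs lam).picone hT hab hq hlam hη ha hb (antiderivative_shift lam hF hG)
    linarith
  have hne : S.Nonempty := by
    obtain ⟨M, hM⟩ := hT.isCompact.exists_bound_of_continuousOn hq.continuousOn
    exact ⟨-M, (hs (-M)).pos_of_nonpos hT hq fun t ht => by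
      linarith [le_abs_self (q t), show |q t| ≤ M from hM t ht]⟩
  have hbdd : BddAbove S := by
    obtain ⟨η, g, hg, hη, ha, hb, t, ht, hηt⟩ := hT.exists_test_function hm
    have hηc := hT.continuousOn_of_deltaDeriv hη
    obtain ⟨F, hF⟩ := hT.exists_antiderivative hq.continuousOn hηc hg.continuousOn
    obtain ⟨G, hG⟩ := hT.exists_antiderivative_sq hηc
    have hpos : 0 < G b - G a := by
      by_contra! h
      exact hηt (hT.eq_zero_of_antiderivative_sq hab hηc ha hG (by linarith) t ht)
    refine ⟨(F b - F a) / (G b - G a), fun lam hlam => ?_⟩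
    rw [le_div_iff₀ hpos]
    exact hray lam hlam η g F G hη ha hb hF hG
  set lam := sSup S
  have hcl : lam ∈ closure S := csSup_mem_closure hne hbdd
  have hray' : ∀ η g F G : ℝ → ℝ,
      (∀ t ∈ kappa T, HasDeltaDerivAt T η (g t) t) → η a = 0 → η b = 0 →
      IsAntiderivative T (fun t => g t ^ 2 - q t * η (sigma T t) ^ 2) F →
      IsAntiderivative T (fun t => η (sigma T t) ^ 2) G →
      lam * (G b - G a) ≤ F b - F a := by
    intro η g F G hη ha hb hF hG
    have hclosed : IsClosed {μ : ℝ | μ * (G b - G a) ≤ F b - F a} :=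
      isClosed_le (by fun_prop) continuous_const
    exact closure_minimal (fun μ hμ => hray μ hμ η g F G hη ha hb hF hG) hclosed hcl
  have hnn : ∀ x ∈ T, 0 ≤ y lam x := by
    intro x hx
    rcases (hT.left_le hx).eq_or_lt with rfl | hax
    · exact ((hs lam).left hab.le).ge
    by_contra! h
    obtain ⟨μ, hμ, hμS⟩ := mem_closure_iff_nhds.1 hcl _ (hc lam (-y lam x) (by linarith))
    have h1 := (abs_lt.1 (hμ x ⟨hax.le, hT.le_right hx⟩)).2
    linarith [hμS x hx hax]
  refine ⟨lam, y lam, v lam, hs lam, ?_, hray'⟩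
  by_contra hyb
  have hlamS : lam ∈ S := by
    intro t ht hat
    rcases (hT.le_right ht).lt_or_eq with htb | rfl
    · exact (hs lam).pos_of_nonneg hT hq hnn ht hat htb
    · exact lt_of_le_of_ne (hnn t ht) (Ne.symm hyb)
  -- Openness provides some `μ > lam` in `S`, against `lam = sSup S`.
  obtain ⟨μ, hμ, hlt⟩ := ((hT.eventually_pos hq hs hc hlamS).filter_mono
    (nhdsWithin_le_nhds (s := Ioi lam))).and self_mem_nhdsWithin |>.exists
  exact absurd (le_csSup hbdd hμ) (not_le.2 hlt)

theorem sigma_eq_right_of_notMem_kappa (hT : IsCompactScale T a b) (h : sigma T t ∉ kappa T) :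
    sigma T t = b ∧ rho T b < b := by
  have h1 : sigma T t = b := by
    by_contra hne
    exact h (hT.mem_kappa_of_lt (hT.sigma_mem t)
      (lt_of_le_of_ne (hT.le_right (hT.sigma_mem t)) hne))
  refine ⟨h1, ?_⟩
  by_contra! h2
  exact h (hT.mem_kappa.2 ⟨hT.sigma_mem t, h1.le.trans h2⟩)

/-- The critical case is `t = ρ b`: then `σ t ∈ T^κ` forces `σ t = t`, hence `ρ b = b` and `T^κ =
T`. -/
theorem mem_kappa_kappa (hT : IsCompactScale T a b) (ht : t ∈ kappa T)
    (h : sigma T t ∈ kappa T) : t ∈ kappa (kappa T) := by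
  rcases (hT.mem_kappa.1 ht).2.lt_or_eq with h1 | h1
  · exact hT.kappa_scale.mem_kappa_of_lt ht h1
  have hσ : sigma T t = t :=
    le_antisymm (h1 ▸ (hT.mem_kappa.1 h).2) (hT.le_sigma (hT.kappa_subset ht))
  have hb : rho T b = b := by
    refine le_antisymm (hT.rho_le hT.left_le_right) ?_
    by_contra! hlt
    obtain ⟨x, hx, h2, h3⟩ := hT.exists_gt_of_sigma_eq hσ (h1.trans_lt hlt) (h1.trans_lt hlt)
    exact absurd (hT.le_rho hx h3) (by linarith)
  have hK : kappa T = T := by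
    ext x
    rw [hT.mem_kappa, hb]
    exact ⟨fun h => h.1, fun h => ⟨h, hT.le_right h⟩⟩
  rwa [hK]

end IsCompactScale

/-! ### From the initial value problem to `C²_rd` solutions and back. -/

theorem IsC2rd.hasDeltaDerivAt {y : ℝ → ℝ} (h : IsC2rd T y) (ht : t ∈ kappa T) :
    HasDeltaDerivAt T y (deltaDeriv T y t) t :=
  (h.diff t ht).hasDeltaDerivAt

theorem IsC2rd.continuousOn {y : ℝ → ℝ} (h : IsC2rd T y) (hT : IsCompactScale T a b) :
    ContinuousOn y T :=
  hT.continuousOn_of_deltaDeriv fun _ ht => h.hasDeltaDerivAt ht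

theorem IsC2rd.continuousOn_deltaDeriv {y : ℝ → ℝ} (h : IsC2rd T y) (hT : IsCompactScale T a b) :
    ContinuousOn (deltaDeriv T y) (kappa T) :=
  hT.kappa_scale.continuousOn_of_deltaDeriv (f' := deltaDeriv2 T y) fun t ht =>
    (h.diff2 t ht).hasDeltaDerivAt

/-- Multiples of solutions of the initial value problem are solutions in the class `C²_rd`. -/
theorem IsShot.isSolution {q q₀ y v : ℝ → ℝ} {lam : ℝ} (hs : IsShot T a b q lam y v)
    (hT : IsCompactScale T a b) (hm : (T ∩ Ioo a b).Nonempty) (hq : Continuous q)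
    (hq₀ : EqOn q₀ q T) (c : ℝ) : IsSolution T q₀ lam fun t => c * y t := by
  obtain ⟨m, hmT, ham, hmb⟩ := hm
  have hab := ham.trans hmb
  have hK := hT.kappa_scale
  have hac : a < rho T b := ham.trans_le (hT.le_rho hmT hmb)
  have hyc := hs.cont
  have hd1 : ∀ t ∈ kappa T, HasDeltaDerivAt T (fun t => c * y t) (c * v t) t := fun t ht =>
    (hs.hasDeltaDerivAt hT (hT.kappa_subset ht)).const_mul c
  have he1 : EqOn (fun t => c * v t) (deltaDeriv T fun t => c * y t) (kappa T) := fun t ht =>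
    (hT.deltaDeriv_eq hab ht (hd1 t ht)).symm
  -- The jump is that of `T^κ`. If `ρ b < b`, it fixes `ρ b`, where the second derivative is a left
  -- derivative with value `-(q + lam) y` rather than `-(q + lam) y^σ`.
  set D : ℝ → ℝ := fun t => c * -((q t + lam) * y (sigma (kappa T) t)) with hD
  have hd2 : ∀ t ∈ kappa (kappa T),
      HasDeltaDerivAt (kappa T) (deltaDeriv T fun t => c * y t) (D t) t := by
    intro t ht
    have htK := hK.kappa_subset ht
    have htT := hT.kappa_subset htK
    refine HasDeltaDerivAt.congr hK ?_ he1
    refine HasDeltaDerivAt.const_mul c ?_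
    by_cases hσ : sigma T t ∈ kappa T
    · rw [hT.hasDeltaDerivAt_kappa_iff htK hσ, hT.sigma_kappa hσ]
      exact hs.hasDeltaDerivAt_deriv hT hq htT
    · obtain ⟨h1, h2⟩ := hT.sigma_eq_right_of_notMem_kappa hσ
      have h3 : t = rho T b := by
        refine le_antisymm (hT.mem_kappa.1 htK).2 ?_
        by_contra! hlt
        linarith [hT.sigma_le (hT.rho_mem hab.le) hlt]
      subst h3
      rw [IsCompactScale.hasDeltaDerivAt_iff_of_eq hK.sigma_right, hK.sigma_right]
      have hset : kappa T = T ∩ Iic (rho T b) := by ext x; exact hT.mem_kappa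
      rw [hset]
      have h4 := (hT.hasDerivWithinAt_primitive_left (h := fun w => (q w.1 + lam) * y w.2)
        (by fun_prop) htT).const_sub 1
      exact h4.congr (fun x _ => hs.derivEq x) (hs.derivEq _)
  have he2 : EqOn (deltaDeriv2 T fun t => c * y t) D (kappa (kappa T)) := fun t ht =>
    hK.deltaDeriv_eq hac ht (hd2 t ht)
  have hDlim : ∀ {s : Set ℝ} {t : ℝ}, Tendsto (sigma (kappa T)) (𝓝[s] t) (𝓝 t) →
      Tendsto D (𝓝[s] t) (𝓝 (c * -((q t + lam) * y t))) := by
    intro s t h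
    have h1 : Tendsto q (𝓝[s] t) (𝓝 (q t)) := (hq.tendsto t).mono_left nhdsWithin_le_nhds
    have h2 : Tendsto (fun x => y (sigma (kappa T) x)) (𝓝[s] t) (𝓝 (y t)) := (hyc.tendsto t).comp h
    exact tendsto_const_nhds.mul ((h1.add tendsto_const_nhds).mul h2).neg
  refine ⟨⟨fun t ht => ⟨_, hd1 t ht⟩, fun t ht => ⟨_, hd2 t ht⟩, fun t ht => ⟨fun hσ => ?_, fun _ =>
    ⟨c * -((q t + lam) * y t), ?_⟩⟩⟩, fun t ht hσ => ?_⟩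
  · have htK := hK.kappa_subset ht
    have hσK : sigma (kappa T) t = t := by rw [hT.sigma_kappa (by rwa [hσ]), hσ]
    have h1 : ContinuousWithinAt D (kappa (kappa T)) t := by
      have h2 := hDlim ((hK.continuousWithinAt_sigma htK hσK).mono_left
        (nhdsWithin_mono _ hK.kappa_subset))
      rw [ContinuousWithinAt]
      convert h2 using 2
      simp only [hD, hσK]
    exact h1.congr he2 (he2 ht)
  · have h2 := hDlim ((hK.tendsto_sigma_left (hK.kappa_subset ht)).mono_left
        (nhdsWithin_mono _ (inter_subset_inter_left _ hK.kappa_subset)))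
    refine h2.congr' ?_
    filter_upwards [self_mem_nhdsWithin] with x hx
    exact (he2 hx.1).symm
  · rw [he2 ht, hq₀ (hT.kappa_subset (hK.kappa_subset ht))]
    simp only [hD, hT.sigma_kappa hσ]
    ring

/-- For a solution with `y(b) = 0`, the product `y y^Δ` is an antiderivative of
`(y^Δ)² - (q + lam) (y^σ)²`. -/
theorem IsSolution.isAntiderivative_mul {q y : ℝ → ℝ} {lam : ℝ} (h : IsSolution T q lam y)
    (hT : IsCompactScale T a b) (hyb : y b = 0) :
    IsAntiderivative T (fun t => deltaDeriv T y t ^ 2 - (q t + lam) * y (sigma T t) ^ 2)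
      (fun t => y t * deltaDeriv T y t) := by
  intro t ht
  beta_reduce
  have htT := hT.kappa_subset ht
  have dy := h.1.hasDeltaDerivAt ht
  by_cases hσ : sigma T t ∈ kappa T
  · have htkk := hT.mem_kappa_kappa ht hσ
    have dg : HasDeltaDerivAt T (deltaDeriv T y) (deltaDeriv2 T y t) t :=
      (hT.hasDeltaDerivAt_kappa_iff ht hσ).1 (h.1.diff2 t htkk).hasDeltaDerivAt
    have heq := h.2 t htkk hσ
    rcases (hT.le_sigma htT).lt_or_eq with h1 | h1
    · rw [IsCompactScale.hasDeltaDerivAt_iff_of_lt htT h1] at dy dg ⊢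
      refine ⟨dy.1.mul dg.1, ?_⟩
      linear_combination y (sigma T t) * dg.2 + deltaDeriv T y t * dy.2
        + y (sigma T t) * (sigma T t - t) * heq
    · rw [IsCompactScale.hasDeltaDerivAt_iff_of_eq h1.symm] at dy dg ⊢
      rw [← h1] at heq ⊢
      refine (dy.mul dg).congr_deriv ?_
      linear_combination y t * heq
  -- Here `t = ρ b < b` and the equation is not available. Since `y b = 0`, the product vanishes at
  -- `b` whatever value `deltaDeriv T y b` has.
  · obtain ⟨h1, h2⟩ := hT.sigma_eq_right_of_notMem_kappa hσ
    have hlt : t < sigma T t := h1 ▸ (hT.mem_kappa.1 ht).2.trans_lt h2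
    have hg : ContinuousWithinAt (deltaDeriv T y) T t := by
      rw [ContinuousWithinAt, ← hT.nhdsWithin_kappa ht]
      exact h.1.continuousOn_deltaDeriv hT t ht
    rw [IsCompactScale.hasDeltaDerivAt_iff_of_lt htT hlt] at dy ⊢
    refine ⟨dy.1.mul hg, ?_⟩
    have e := dy.2
    rw [h1, hyb] at e ⊢
    linear_combination deltaDeriv T y t * e

theorem interval_scale {𝕋 : Set ℝ} (h𝕋 : IsClosed 𝕋) (ha : a ∈ 𝕋) (hb : b ∈ 𝕋) (hab : a ≤ b) :
    IsCompactScale (interval 𝕋 a b) a b where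
  isCompact := isCompact_Icc.inter_left h𝕋
  isLeast := ⟨⟨ha, le_rfl, hab⟩, fun _ ht => ht.2.1⟩
  isGreatest := ⟨⟨hb, hab, le_rfl⟩, fun _ ht => ht.2.2⟩

/-! ### The Rayleigh quotient and the least eigenvalue. -/

section Rayleigh

variable {𝕋 : Set ℝ} {q y : ℝ → ℝ}

theorem I_eq {F : ℝ → ℝ} (hT : IsCompactScale (interval 𝕋 a b) a b)
    (hF : IsAntiderivative (interval 𝕋 a b) (fun t => y (sigma (interval 𝕋 a b) t) ^ 2) F) :
    I 𝕋 a b y = F b - F a :=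
  hT.deltaIntegral_eq hF

theorem J_eq {F : ℝ → ℝ} (hT : IsCompactScale (interval 𝕋 a b) a b)
    (hF : IsAntiderivative (interval 𝕋 a b) (fun t => deltaDeriv (interval 𝕋 a b) y t ^ 2 -
      q t * y (sigma (interval 𝕋 a b) t) ^ 2) F) :
    J 𝕋 a b q y = F b - F a :=
  hT.deltaIntegral_eq hF

/-- `J y - lam * I y` is the increment of `y y^Δ` from `a` to `b`, and `y` vanishes at both ends. -/
theorem IsEigenfunction.J_eq_mul {lam : ℝ} (hT : IsCompactScale (interval 𝕋 a b) a b)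
    (hq : ContinuousOn q (interval 𝕋 a b)) (hy : IsEigenfunction 𝕋 a b q lam y) :
    J 𝕋 a b q y = lam * I 𝕋 a b y := by
  obtain ⟨hsol, hya, hyb, -⟩ := hy
  have hc := hsol.1.continuousOn hT
  obtain ⟨F, hF⟩ := hT.exists_antiderivative hq hc (hsol.1.continuousOn_deltaDeriv hT)
  obtain ⟨G, hG⟩ := hT.exists_antiderivative_sq hc
  have h := hT.antiderivative_sub_eq (IsCompactScale.antiderivative_shift lam hF hG)
    (hsol.isAntiderivative_mul hT hyb) hT.left_mem hT.right_mem hT.left_le_right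
  rw [J_eq hT hF, I_eq hT hG]
  simp only [hya, hyb, zero_mul, sub_zero] at h
  linarith

theorem IsEigenfunction.I_pos {lam : ℝ} (hT : IsCompactScale (interval 𝕋 a b) a b) (hab : a < b)
    (hy : IsEigenfunction 𝕋 a b q lam y) : 0 < I 𝕋 a b y := by
  obtain ⟨hsol, hya, -, t, ht, hyt⟩ := hy
  have hc := hsol.1.continuousOn hT
  obtain ⟨G, hG⟩ := hT.exists_antiderivative_sq hc
  rw [I_eq hT hG]
  by_contra! h
  exact hyt (hT.eq_zero_of_antiderivative_sq hab hc hya hG (by linarith) t ht)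

/-- The least eigenvalue exists, has a normalized eigenfunction and bounds the Rayleigh quotient
from below. -/
theorem exists_isLeast_eigenvalues (hT : IsCompactScale (interval 𝕋 a b) a b)
    (hm : (𝕋 ∩ Ioo a b).Nonempty) (hq : ContinuousOn q (interval 𝕋 a b)) :
    ∃ (lam : ℝ) (y : ℝ → ℝ), IsLeast (eigenvalues 𝕋 a b q) lam ∧ IsEigenfunction 𝕋 a b q lam y ∧
      I 𝕋 a b y = 1 ∧ ∀ z, IsC2rd (interval 𝕋 a b) z → z a = 0 → z b = 0 →
        lam * I 𝕋 a b z ≤ J 𝕋 a b q z := by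
  have hm' : (interval 𝕋 a b ∩ Ioo a b).Nonempty := by
    obtain ⟨m, hmT, h1, h2⟩ := hm
    exact ⟨m, ⟨hmT, h1.le, h2.le⟩, h1, h2⟩
  have hab : a < b := by
    obtain ⟨m, -, h1, h2⟩ := hm
    exact h1.trans h2
  obtain ⟨q', hq', hqq⟩ := hT.exists_continuous_eqOn hq
  obtain ⟨lam, u, v, hs, hub, hray⟩ := hT.exists_first_eigenvalue hm' hq'
  have hlow : ∀ z, IsC2rd (interval 𝕋 a b) z → z a = 0 → z b = 0 →
      lam * I 𝕋 a b z ≤ J 𝕋 a b q z := by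
    intro z hz hza hzb
    have hc := hz.continuousOn hT
    obtain ⟨F, hF⟩ := hT.exists_antiderivative hq hc (hz.continuousOn_deltaDeriv hT)
    obtain ⟨G, hG⟩ := hT.exists_antiderivative_sq hc
    rw [J_eq hT hF, I_eq hT hG]
    refine hray z _ F G (fun t ht => hz.hasDeltaDerivAt ht) hza hzb (hF.congr fun t ht => ?_) hG
    simp only [hqq (hT.kappa_subset ht)]
  have heig : ∀ c : ℝ, c ≠ 0 → IsEigenfunction 𝕋 a b q lam fun t => c * u t := by
    intro c hc
    obtain ⟨t, ht, hut⟩ := hs.ne_zero hT hab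
    exact ⟨hs.isSolution hT hm' hq' hqq c, by simp [hs.left hab.le], by simp [hub],
      t, ht, mul_ne_zero hc hut⟩
  obtain ⟨G, hG⟩ := hT.exists_antiderivative_sq hs.cont.continuousOn
  have hI : ∀ c : ℝ, I 𝕋 a b (fun t => c * u t) = c ^ 2 * (G b - G a) := by
    intro c
    have h1 : IsAntiderivative (interval 𝕋 a b)
        (fun t => (c * u (sigma (interval 𝕋 a b) t)) ^ 2) (fun t => c ^ 2 * G t) := fun t ht => by
      beta_reduce
      rw [mul_pow]
      exact (hG t ht).const_mul (c ^ 2)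
    rw [I_eq hT h1]
    ring
  have hpos : 0 < G b - G a := by
    have := (heig 1 one_ne_zero).I_pos hT hab
    rw [hI] at this
    linarith
  have hsqrt := Real.sqrt_pos.2 hpos
  refine ⟨lam, fun t => (√(G b - G a))⁻¹ * u t, ⟨⟨_, heig 1 one_ne_zero⟩, ?_⟩,
    heig _ (inv_ne_zero hsqrt.ne'), ?_, hlow⟩
  -- For an eigenfunction `z` of `μ`, `lam * I z ≤ J z = μ * I z`, and `I z > 0` can be cancelled.
  · rintro μ ⟨z, hz⟩
    have h1 := hlow z hz.1.1 hz.2.1 hz.2.2.1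
    rw [hz.J_eq_mul hT hq] at h1
    exact le_of_mul_le_mul_right h1 (hz.I_pos hT hab)
  · rw [hI, inv_pow, Real.sq_sqrt hpos.le, inv_mul_cancel₀ hpos.ne']

end Rayleigh

end TimeScale

theorem theorem2 (𝕋 : Set ℝ) (h𝕋 : IsClosed 𝕋) (a b : ℝ) (ha : a ∈ 𝕋) (hb : b ∈ 𝕋) (hab : a < b)
    (q : ℝ → ℝ) (hq : ContinuousOn q (TimeScale.interval 𝕋 a b)) :
    -- the first eigenvalue and a normalized eigenfunction exist once `[a, b]` has a third point
    ((𝕋 ∩ Set.Ioo a b).Nonempty →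
      ∃ (lam₁ : ℝ) (y₁ : ℝ → ℝ), IsLeast (TimeScale.eigenvalues 𝕋 a b q) lam₁ ∧
        TimeScale.IsEigenfunction 𝕋 a b q lam₁ y₁ ∧ TimeScale.I 𝕋 a b y₁ = 1) ∧
    ∀ (lam₁ : ℝ) (y₁ : ℝ → ℝ), IsLeast (TimeScale.eigenvalues 𝕋 a b q) lam₁ →
      TimeScale.IsEigenfunction 𝕋 a b q lam₁ y₁ → TimeScale.I 𝕋 a b y₁ = 1 →
      y₁ ∈ TimeScale.admissible 𝕋 a b ∧
        IsMinOn (TimeScale.J 𝕋 a b q) (TimeScale.admissible 𝕋 a b) y₁ ∧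
        TimeScale.J 𝕋 a b q y₁ = lam₁ := by
  have hT := TimeScale.interval_scale h𝕋 ha hb hab.le
  refine ⟨fun hm => ?_, fun lam₁ y₁ hleast hy hI => ?_⟩
  · obtain ⟨lam, y, h1, h2, h3, -⟩ := TimeScale.exists_isLeast_eigenvalues hT hm hq
    exact ⟨lam, y, h1, h2, h3⟩
  · have hJ : TimeScale.J 𝕋 a b q y₁ = lam₁ := by rw [hy.J_eq_mul hT hq, hI, mul_one]
    -- A third point need not be assumed here: an eigenfunction is nonzero somewhere, and not at an
    -- end.
    have hm : (𝕋 ∩ Set.Ioo a b).Nonempty := by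
      obtain ⟨-, hya, hyb, t, ht, hyt⟩ := hy
      exact ⟨t, ht.1, lt_of_le_of_ne ht.2.1 fun e => hyt (e ▸ hya),
        lt_of_le_of_ne ht.2.2 fun e => hyt (e ▸ hyb)⟩
    refine ⟨⟨hy.1.1, hy.2.1, hy.2.2.1, hI⟩, fun z hz => ?_, hJ⟩
    obtain ⟨lam, -, h1, -, -, hlow⟩ := TimeScale.exists_isLeast_eigenvalues hT hm hq
    obtain rfl := h1.unique hleast
    have h2 := hlow z hz.1 hz.2.1 hz.2.2.1
    rw [hz.2.2.2, mul_one] at h2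
    exact hJ.le.trans h2
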